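/- Let $X$ be a CAT(0) cube complex, possibly infinite-dimensional and not locally finite: a nonempty, simply connected cube complex in which the link of every vertex is a flag simplicial complex. Let a group $G$ act on $X$ by cellular automorphisms (mapping cubes isometrically to cubes) without a fixed point (no point of $X$ is fixed by all of $G$) and without inversions (whenever $g\in G$ stabilizes a hyperplane $\Lambda$ of $X$, it also stabilizes each component of $X\setminus\Lambda$). A subcomplex of $X$ is convex if it contains every cube of $X$ all of whose vertices lie in it and every combinatorial geodesic of $X$ between two of its vertices. A minimal $G$-invariant convex subcomplex is a nonempty $G$-invariant convex subcomplex $X_o\subseteq X$ that contains no other nonempty $G$-invariant convex subcomplex and such that no nonempty $G$-invariant convex subcomplex of $X$ has fewer $G$-orbits of hyperplanes than $X_o$. For a subgroup $H\leqslant G$, a set $A\subseteq G$ is $H$-finite if $A\subseteq HF$ for some finite $F\subseteq G$; the subgroup $H$ is codimension-1 if there is $A\subseteq G$ such that $A=HA$, the symmetric difference of $A$ and $Ag$ is $H$-finite for every $g\in G$, and neither $A$ nor $G\setminus A$ is $H$-finite. A group is virtually abelian of rank $n$ if it has a finite-index subgroup isomorphic to $\mathbb{Z}^n$. 1. If $G$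 is finitely generated, then there is a minimal $G$-invariant convex subcomplex $X_o\subseteq X$ such that $X_o$ has only finitely many $G$-orbits of hyperplanes and the stabilizer in $G$ of every hyperplane of $X_o$ is a codimension-1 subgroup of $G$. 2. If $G$ is virtually abelian of rank $n$, then there is a minimal $G$-invariant convex subcomplex $X_o\subseteq X$ such that $X_o$ has only finitely many $G$-orbits of hyperplanes and the stabilizer in $G$ of every hyperplane of $X_o$ is virtually abelian of rank $n-1$. -/

import Mathlib

open scoped Pointwise

/-! ### Cube complexes -/

/-- A face of the combinatorial cube `{0,1}ⁿ`: some of the coordinates are prescribed. -/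
def IsCubeFace {n : ℕ} (F : Set (Fin n → Bool)) : Prop :=
  ∃ (S : Set (Fin n)) (a : Fin n → Bool), F = {x | ∀ i ∈ S, x i = a i}

/-- `φ` identifies the combinatorial cube `{0,1}ⁿ` with the vertex set `Set.range φ`, in such a way
that the members of the family `cubes` that lie inside `Set.range φ` are exactly the images of the
faces of `{0,1}ⁿ` (in particular `Set.range φ` itself is one of them). -/
def IsCubeChart {V : Type*} (cubes : Set (Set V)) {n : ℕ} (φ : (Fin n → Bool) → V) : Prop :=
  Function.Injective φ ∧
    ∀ D ⊆ Set.range φ, (D ∈ cubes ↔ ∃ F, IsCubeFace F ∧ D = φ '' F)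

/-- A cubical complex, each (closed, finite-dimensional) cube being recorded by its set of vertices:
every cube is an embedded copy of `[0,1]ⁿ` for some `n`, the faces of a cube are cubes, and two
cubes that meet do so in a common face.  The dimension of the cubes need not be bounded and the
complex need not be locally finite.  The vertices of the complex are the `v : V` for which `{v}` is
a cube; the type `V` may contain further elements, so that subcomplexes are complexes on the same
type. -/
structure CubeComplex (V : Type*) where
  cubes : Set (Set V)
  exists_chart : ∀ C ∈ cubes, ∃ (n : ℕ) (φ : (Fin n → Bool) → V),
    IsCubeChart cubes φ ∧ Set.range φ = C
  inter_mem : ∀ C ∈ cubes, ∀ D ∈ cubes, (C ∩ D).Nonempty → C ∩ D ∈ cubes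

namespace CubeComplex

variable {V : Type*}

/-- The `0`-cubes. -/
def vertices (X : CubeComplex V) : Set V := {v | {v} ∈ X.cubes}

/-- The `1`-skeleton. -/
def graph (X : CubeComplex V) : SimpleGraph V where
  Adj v w := v ≠ w ∧ {v, w} ∈ X.cubes
  symm := ⟨fun v w h => ⟨h.1.symm, by rw [Set.pair_comm]; exact h.2⟩⟩
  loopless := ⟨fun _ h => h.1 rfl⟩

/-- `a, b, c, d` are, in cyclic order, the vertices of a `2`-cube. -/
structure IsSquare (X : CubeComplex V) (a b c d : V) : Prop where
  mem : {a, b, c, d} ∈ X.cubes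
  ab : X.graph.Adj a b
  bc : X.graph.Adj b c
  ad : X.graph.Adj a d
  dc : X.graph.Adj d c
  ac : a ≠ c
  bd : b ≠ d

/-! ### The CAT(0) condition -/

/-- Homotopy of edge paths relative to their endpoints: the congruence generated by removing
backtracks and by pushing a path across a `2`-cube. -/
inductive Homotopic (X : CubeComplex V) :
    ∀ {u v : V}, X.graph.Walk u v → X.graph.Walk u v → Prop
  | refl {u v : V} (p : X.graph.Walk u v) : Homotopic X p p
  | symm {u v : V} {p q : X.graph.Walk u v} : Homotopic X p q → Homotopic X q p
  | trans {u v : V} {p q r : X.graph.Walk u v} :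
      Homotopic X p q → Homotopic X q r → Homotopic X p r
  | cons {u v w : V} (h : X.graph.Adj u v) {p q : X.graph.Walk v w} :
      Homotopic X p q → Homotopic X (SimpleGraph.Walk.cons h p) (SimpleGraph.Walk.cons h q)
  | backtrack {u v w : V} (h : X.graph.Adj u v) (p : X.graph.Walk u w) :
      Homotopic X (SimpleGraph.Walk.cons h (SimpleGraph.Walk.cons h.symm p)) p
  | square {a b c d w : V} (s : X.IsSquare a b c d) (p : X.graph.Walk c w) :
      Homotopic X (SimpleGraph.Walk.cons s.ab (SimpleGraph.Walk.cons s.bc p))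
        (SimpleGraph.Walk.cons s.ad (SimpleGraph.Walk.cons s.dc p))

/-- The complex is nonempty, connected, and its edge-path group is trivial. -/
structure IsSimplyConnected (X : CubeComplex V) : Prop where
  nonempty : X.vertices.Nonempty
  reachable : ∀ u ∈ X.vertices, ∀ v ∈ X.vertices, X.graph.Reachable u v
  null_homotopic : ∀ u ∈ X.vertices, ∀ p : X.graph.Walk u u,
    X.Homotopic p SimpleGraph.Walk.nil

/-- The simplices of the link of `v`.  The vertices of the link are the edges at `v`, each recorded
by its other endpoint; a set of them is a simplex if these edges lie in a common cube. -/
def IsLinkSimplex (X : CubeComplex V) (v : V) (s : Finset V) : Prop :=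
  (∀ w ∈ s, X.graph.Adj v w) ∧ ∃ C ∈ X.cubes, v ∈ C ∧ (s : Set V) ⊆ C

open scoped Classical in
/-- Every vertex link is a flag complex: finitely many vertices of the link that are pairwise joined
by edges of the link span a simplex of the link. -/
def HasFlagLinks (X : CubeComplex V) : Prop :=
  ∀ v ∈ X.vertices, ∀ s : Finset V, (∀ w ∈ s, X.graph.Adj v w) →
    (∀ a ∈ s, ∀ b ∈ s, a ≠ b → X.IsLinkSimplex v {a, b}) → X.IsLinkSimplex v s

/-- A CAT(0) cube complex: a simply connected cube complex all of whose vertex links are flag. -/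
structure IsCAT0 (X : CubeComplex V) : Prop where
  simplyConnected : X.IsSimplyConnected
  flag : X.HasFlagLinks

/-! ### Points -/

open scoped Classical in
/-- The geometric realization.  The point with coordinates `t ∈ [0,1]ⁿ` of the cube with chart `φ`
is recorded by its weights on the vertices of the complex: the vertex `φ x` has weight
`∏ i, (t i if x i = 1, and 1 - t i if x i = 0)`, all other vertices have weight `0`.  The weights
determine the smallest cube that contains the point, and its coordinates there. -/
def points (X : CubeComplex V) : Set (V → ℝ) :=
  {f | ∃ (n : ℕ) (φ : (Fin n → Bool) → V) (t : Fin n → ℝ), IsCubeChart X.cubes φ ∧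
    (∀ i, t i ∈ Set.Icc (0 : ℝ) 1) ∧
    ∀ v, f v = ∑ x : Fin n → Bool,
      if φ x = v then ∏ i, (if x i = true then t i else 1 - t i) else 0}

/-! ### Hyperplanes -/

/-- Two edges are opposite edges of a `2`-cube. -/
def Opposite (X : CubeComplex V) (e e' : Sym2 V) : Prop :=
  ∃ a b c d, X.IsSquare a b c d ∧ e = s(a, b) ∧ e' = s(d, c)

/-- The hyperplanes of `X`, each recorded by the set of edges dual to it: the classes of edges under
the equivalence relation generated by being opposite in a `2`-cube. -/
def hyperplanes (X : CubeComplex V) : Set (Set (Sym2 V)) :=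
  {L | ∃ e ∈ X.graph.edgeSet, L = {e' | Relation.EqvGen X.Opposite e e'}}

/-- The vertex sets of the components of the complement of the hyperplane `L` in `X`. -/
def complementaryComponents (X : CubeComplex V) (L : Set (Sym2 V)) : Set (Set V) :=
  {K | ∃ v ∈ X.vertices, K = {w | (X.graph.deleteEdges L).Reachable v w}}

/-! ### Convex subcomplexes -/

/-- `Y` is a nonempty convex subcomplex of `X`: it contains every cube of `X` all of whose vertices
lie in `Y`, and every combinatorial geodesic of `X` that joins two vertices of `Y`. -/
structure IsConvexSubcomplex (X Y : CubeComplex V) : Prop where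
  nonempty : Y.vertices.Nonempty
  subset : Y.cubes ⊆ X.cubes
  full : ∀ C ∈ X.cubes, C ⊆ Y.vertices → C ∈ Y.cubes
  geodesic : ∀ u ∈ Y.vertices, ∀ v ∈ Y.vertices, ∀ p : X.graph.Walk u v,
    p.length = X.graph.dist u v → ∀ w ∈ p.support, w ∈ Y.vertices

/-! ### Group actions -/

section Action

variable (G : Type*) [Group G] [MulAction G V]

/-- The action of `G` on `V` preserves the cell structure of `X`. -/
def IsInvariant (X : CubeComplex V) : Prop :=
  ∀ (g : G), ∀ C ∈ X.cubes, g • C ∈ X.cubes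

/-- No point of (the geometric realization of) `X` is fixed by all of `G`. -/
def NoFixedPoint (X : CubeComplex V) : Prop :=
  ¬ ∃ f ∈ X.points, ∀ (g : G) (v : V), f (g⁻¹ • v) = f v

variable {G}

/-- The translate by `g` of a hyperplane. -/
def translate (g : G) (L : Set (Sym2 V)) : Set (Sym2 V) :=
  Sym2.map (fun v => g • v) '' L

theorem translate_one (L : Set (Sym2 V)) : translate (1 : G) L = L := by
  simp [translate]

theorem translate_mul (g h : G) (L : Set (Sym2 V)) :
    translate (g * h) L = translate g (translate h L) := by
  simp only [translate, Set.image_image, Sym2.map_map]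
  congr 1
  funext e
  congr 1
  funext v
  exact mul_smul g h v

variable (G)

/-- The stabilizer in `G` of a hyperplane. -/
def hyperplaneStabilizer (L : Set (Sym2 V)) : Subgroup G where
  carrier := {g | translate g L = L}
  one_mem' := translate_one L
  mul_mem' {g h} hg hh := by
    simp only [Set.mem_ofPred_eq] at hg hh ⊢
    rw [translate_mul, hh, hg]
  inv_mem' {g} hg := by
    simp only [Set.mem_ofPred_eq] at hg ⊢
    conv_lhs => rw [← hg]
    rw [← translate_mul, inv_mul_cancel, translate_one]

/-- The action is without inversions: the stabilizer of a hyperplane also stabilizes each of its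
complementary components. -/
def NoInversions (X : CubeComplex V) : Prop :=
  ∀ L ∈ X.hyperplanes, ∀ g ∈ hyperplaneStabilizer G L,
    ∀ K ∈ X.complementaryComponents L, g • K = K

/-- The set of `G`-orbits of hyperplanes of `X`. -/
def hyperplaneOrbits (X : CubeComplex V) : Set (Set (Set (Sym2 V))) :=
  {O | ∃ L ∈ X.hyperplanes, O = Set.range fun g : G => translate g L}

/-- `Y` is a minimal `G`-invariant convex subcomplex of `X`: it is nonempty, `G`-invariant and
convex, it contains no other such subcomplex, and no such subcomplex of `X` has fewer orbits of
hyperplanes. -/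
structure IsMinimalInvariantConvex (X Y : CubeComplex V) : Prop where
  convex : X.IsConvexSubcomplex Y
  invariant : Y.IsInvariant G
  minimal : ∀ Z : CubeComplex V, X.IsConvexSubcomplex Z → Z.IsInvariant G →
    Z.cubes ⊆ Y.cubes → Z.cubes = Y.cubes
  minimal_orbits : ∀ Z : CubeComplex V, X.IsConvexSubcomplex Z → Z.IsInvariant G →
    (Y.hyperplaneOrbits G).encard ≤ (Z.hyperplaneOrbits G).encard

end Action

end CubeComplex

/-! ### Subgroups -/

/-- `A` is `H`-finite: `A ⊆ H F` for some finite `F`. -/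
def IsHFinite {G : Type*} [Group G] (H : Subgroup G) (A : Set G) : Prop :=
  ∃ F : Set G, F.Finite ∧ A ⊆ (H : Set G) * F

/-- `H` is a codimension-1 subgroup of `G`: there is an `H`-invariant, `H`-almost invariant and
`H`-proper subset of `G`. -/
def IsCodimensionOne {G : Type*} [Group G] (H : Subgroup G) : Prop :=
  ∃ A : Set G, (H : Set G) * A = A ∧
    (∀ g : G, IsHFinite H (symmDiff A ((fun a => a * g) '' A))) ∧
    ¬ IsHFinite H A ∧ ¬ IsHFinite H Aᶜ

/-- `G` is virtually abelian of rank `n`: it has a subgroup of finite index isomorphic to `ℤⁿ`. -/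
def IsVirtuallyAbelianOfRank (G : Type*) [Group G] (n : ℕ) : Prop :=
  ∃ H : Subgroup G, H.FiniteIndex ∧ Nonempty (H ≃* Multiplicative (Fin n → ℤ))

/-! Everything takes place in the 1-skeleton. A hyperplane is handled through the two halfspaces of
a dual edge, where `halfspace a b` consists of the vertices closer to `a` than to `b`. Simple
connectivity and flag links are turned into geometry by a van der Waerden argument: edge paths act
on reduced paths modulo pushing across squares, flag links make this action well defined and
homotopy invariant, and so reduced paths with the same endpoints differ by square moves
(`IsCAT0.swap`). Hence adjacent vertices are never equidistant from a third one and the quadrangle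
condition holds. These give convexity of halfspaces, gates in convex sets, and finiteness of the set
of halfspaces separating two vertices.

For finitely generated `G`, the hull of a vertex orbit is crossed by finitely many orbits of
hyperplanes, each represented by one separating `v` from `s • v` for a generator `s`. An invariant
convex set `Y` crossed by the fewest orbits is then minimal under inclusion, since a proper
invariant convex subset would miss a whole orbit of hyperplanes crossing `Y`.

The heart is `IsMinimalSet.not_pointFinite`: for a halfspace `h` crossing `Y`, some vertex of `Y`
lies in infinitely many translates of `h`. Otherwise minimality gives `g₁` such that `h` and `g₁ •
h` cover `Y`, which forces the orbit of `h` to be finite. The same argument for the opposite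
halfspace gives `g₂` such that `h` and `g₂ • h` are disjoint in `Y`. Then `g₁ * g₂` maps `h`
strictly into itself within `Y`, equality being ruled out by the absence of inversions, and this is
impossible in a finite orbit.

Let `H` be the stabilizer of the hyperplane, equivalently of `h`. The set of `g` with `g • v ∈ h` is
`H`-invariant, and `H`-almost invariant because finitely many halfspaces separate two given
vertices. Neither it nor its complement is `H`-finite, by the previous paragraph for `h` and its
opposite. So `H` has codimension 1.

If `G` contains `ℤⁿ` with finite index, such a set descends to `ℤⁿ / P`, where `P` is the preimage
of `H`, and exhibits at least two ends there. A finitely generated abelian group with this property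
has rank 1, so `P` has rank `n - 1`. -/

namespace CubeComplex

variable {V : Type*} {X : CubeComplex V}

/-! ### Cubes and squares -/

theorem ncard_of_mem_cubes {C : Set V} (hC : C ∈ X.cubes) : ∃ n : ℕ, C.ncard = 2 ^ n := by
  obtain ⟨n, φ, hφ, rfl⟩ := X.exists_chart C hC
  refine ⟨n, ?_⟩
  rw [← Set.image_univ, Set.ncard_image_of_injective _ hφ.1, Set.ncard_univ]
  simp

theorem singleton_mem_cubes {C : Set V} (hC : C ∈ X.cubes) {v : V} (hv : v ∈ C) :
    {v} ∈ X.cubes := by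
  obtain ⟨n, φ, hφ, rfl⟩ := X.exists_chart C hC
  obtain ⟨x, rfl⟩ := hv
  refine (hφ.2 _ (by simp)).2 ⟨{x}, ⟨Set.univ, x, ?_⟩, by simp⟩
  ext y
  simp [funext_iff]

theorem subset_vertices {C : Set V} (hC : C ∈ X.cubes) : C ⊆ X.vertices :=
  fun _ hv => singleton_mem_cubes hC hv

theorem mem_vertices_left {v w : V} (h : X.graph.Adj v w) : v ∈ X.vertices :=
  singleton_mem_cubes h.2 (by simp)

theorem mem_vertices_right {v w : V} (h : X.graph.Adj v w) : w ∈ X.vertices :=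
  singleton_mem_cubes h.2 (by simp)

namespace IsSquare

variable {a b c d : V}

theorem reflect (s : X.IsSquare a b c d) : X.IsSquare a d c b where
  mem := by
    have : ({a, d, c, b} : Set V) = {a, b, c, d} := by ext; simp; tauto
    rw [this]; exact s.mem
  ab := s.ad
  bc := s.dc
  ad := s.ab
  dc := s.bc
  ac := s.ac
  bd := s.bd.symm

theorem rotate (s : X.IsSquare a b c d) : X.IsSquare b c d a where
  mem := by
    have : ({b, c, d, a} : Set V) = {a, b, c, d} := by ext; simp; tauto
    rw [this]; exact s.mem
  ab := s.bc
  bc := s.dc.symm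
  ad := s.ab.symm
  dc := s.ad
  ac := s.bd
  bd := s.ac.symm

/-- Otherwise the two squares would meet in exactly three vertices, while the intersection is a cube
and has a power of 2 of them. -/
theorem unique {d' : V} (s : X.IsSquare a b c d) (s' : X.IsSquare a b c d') : d = d' := by
  by_contra hne
  have h : ({a, b, c, d} ∩ {a, b, c, d'} : Set V) = {a, b, c} := by
    ext x
    have h1 := s.ad.1
    have h2 := s.dc.1
    have h3 := s.bd
    simp only [Set.mem_inter_iff, Set.mem_insert_iff, Set.mem_singleton_iff]
    grind
  have hm := X.inter_mem _ s.mem _ s'.mem (by rw [h]; simp)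
  rw [h] at hm
  obtain ⟨n, hn⟩ := ncard_of_mem_cubes hm
  have h3 : ({a, b, c} : Set V).ncard = 3 :=
    Set.ncard_eq_three.2 ⟨a, b, c, s.ab.1, s.ac, s.bc.1, rfl⟩
  rw [h3] at hn
  rcases n with _ | n
  · simp at hn
  · rw [pow_succ] at hn; omega

theorem unique_opposite {c' : V} (s : X.IsSquare a b c d) (s' : X.IsSquare a b c' d) : c = c' :=
  s.rotate.rotate.rotate.unique s'.rotate.rotate.rotate

end IsSquare

/-- The vertex of the combinatorial cube that differs from `x` in the coordinate `i`. -/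
def flip {n : ℕ} (x : Fin n → Bool) (i : Fin n) : Fin n → Bool := Function.update x i (!x i)

theorem flip_ne {n : ℕ} (x : Fin n → Bool) (i : Fin n) : flip x i ≠ x := by
  intro h
  have := congrFun h i
  simp [flip] at this

theorem flip_apply {n : ℕ} (x : Fin n → Bool) (i j : Fin n) :
    flip x i j = if j = i then !x i else x j := by
  simp [flip, Function.update_apply]

theorem flip_inj {n : ℕ} {x : Fin n → Bool} {i j : Fin n} (h : flip x i = flip x j) : i = j := by
  by_contra hne
  have := congrFun h i
  simp [flip_apply, hne] at this

theorem flip_comm {n : ℕ} (x : Fin n → Bool) (i j : Fin n) :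
    flip (flip x i) j = flip (flip x j) i := by
  funext k
  simp only [flip_apply]
  grind

/-! ### Edges and squares of a cube in coordinates -/

section Chart

variable {n : ℕ} {φ : (Fin n → Bool) → V} (hφ : IsCubeChart X.cubes φ)

include hφ

theorem adj_flip (x : Fin n → Bool) (i : Fin n) : X.graph.Adj (φ x) (φ (flip x i)) := by
  refine ⟨fun h => flip_ne x i (hφ.1 h).symm, (hφ.2 _ ?_).2
    ⟨{x, flip x i}, ⟨{i}ᶜ, x, ?_⟩, (Set.image_pair _ _ _).symm⟩⟩
  · rintro _ (rfl | rfl) <;> exact ⟨_, rfl⟩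
  · ext y
    simp only [Set.mem_insert_iff, Set.mem_singleton_iff, Set.mem_compl_iff, Set.mem_ofPred_eq]
    constructor
    · rintro (rfl | rfl) j hj
      · rfl
      · simp [flip_apply, hj]
    · intro h
      by_cases hy : y i = x i
      · left; funext j; by_cases hj : j = i
        · rw [hj, hy]
        · exact h j hj
      · right; funext j; by_cases hj : j = i
        · subst hj; simp [flip_apply]; cases h1 : y j <;> cases h2 : x j <;> simp_all
        · simp [flip_apply, hj, h j hj]

theorem eq_flip_of_adj {x y : Fin n → Bool} (h : X.graph.Adj (φ x) (φ y)) : ∃ i, y = flip x i := by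
  obtain ⟨F, ⟨S, a, rfl⟩, hF⟩ := (hφ.2 {φ x, φ y} (by rintro _ (rfl | rfl) <;> exact ⟨_, rfl⟩)).1 h.2
  rw [← Set.image_pair, hφ.1.image_injective.eq_iff] at hF
  have hx : x ∈ {x | ∀ i ∈ S, x i = a i} := by rw [← hF]; simp
  have hy : y ∈ {x | ∀ i ∈ S, x i = a i} := by rw [← hF]; simp
  have hxy : x ≠ y := fun e => h.1 (by rw [e])
  obtain ⟨i, hi⟩ := Function.ne_iff.1 hxy
  refine ⟨i, ?_⟩
  have hm : flip x i ∈ ({x, y} : Set (Fin n → Bool)) := by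
    rw [hF]
    intro j hj
    have hji : j ≠ i := by
      rintro rfl
      exact hi ((hx j hj).trans (hy j hj).symm)
    simpa [flip_apply, hji] using hx j hj
  rcases hm with hm | hm
  · exact absurd hm (flip_ne x i)
  · exact (Set.mem_singleton_iff.1 hm).symm

theorem isSquare_flip (x : Fin n → Bool) {i j : Fin n} (hij : i ≠ j) :
    X.IsSquare (φ x) (φ (flip x i)) (φ (flip (flip x i) j)) (φ (flip x j)) where
  mem := by
    refine (hφ.2 _ ?_).2 ⟨{x, flip x i, flip (flip x i) j, flip x j}, ⟨{i, j}ᶜ, x, ?_⟩, ?_⟩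
    · rintro _ (rfl | rfl | rfl | rfl) <;> exact ⟨_, rfl⟩
    · ext y
      simp only [Set.mem_insert_iff, Set.mem_singleton_iff, Set.mem_compl_iff, Set.mem_ofPred_eq]
      constructor
      · rintro (rfl | rfl | rfl | rfl) k hk <;> simp only [not_or] at hk <;> simp [flip_apply, hk]
      · intro h
        have key : ∀ z : Fin n → Bool, (∀ k, k ≠ i → k ≠ j → z k = x k) → y i = z i → y j = z j →
            y = z := by
          intro z hz h1 h2
          funext k
          by_cases hki : k = i
          · rw [hki, h1]
          by_cases hkj : k = j
          · rw [hkj, h2]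
          rw [hz k hki hkj, h k (by simp [hki, hkj])]
        have hb : ∀ p q : Bool, p = q ∨ p = !q := by decide
        rcases hb (y i) (x i) with h1 | h1 <;> rcases hb (y j) (x j) with h2 | h2
        · left; exact key _ (by simp) h1 h2
        · right; right; right
          exact key _ (by simp +contextual [flip_apply]) (by simp [flip_apply, hij, h1])
            (by simp [flip_apply, h2])
        · right; left
          exact key _ (by simp +contextual [flip_apply]) (by simp [flip_apply, h1])
            (by simp [flip_apply, h2, hij.symm])
        · right; right; left
          exact key _ (by simp +contextual [flip_apply]) (by simp [flip_apply, h1, hij])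
            (by simp [flip_apply, h2, hij.symm])
    · simp [Set.image_insert_eq]
  ab := adj_flip hφ _ _
  bc := adj_flip hφ _ _
  ad := adj_flip hφ _ _
  dc := by rw [flip_comm]; exact adj_flip hφ _ _
  ac h := by
    have := congrFun (hφ.1 h) i
    simp [flip_apply, hij] at this
  bd h := hij (flip_inj (hφ.1 h))

end Chart

/-- Three squares at a vertex `v` of a complex with flag links that pairwise share an edge are
the squares at `v` of a `3`-cube. -/
theorem HasFlagLinks.exists_cube (hX : X.HasFlagLinks) {v x y z p q r : V}
    (sxy : X.IsSquare v x p y) (syz : X.IsSquare v y q z) (sxz : X.IsSquare v x r z) :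
    ∃ u, X.IsSquare x p u r ∧ X.IsSquare y p u q ∧ X.IsSquare z q u r := by
  classical
  have hsimp : X.IsLinkSimplex v {x, y, z} := by
    have adj : ∀ w ∈ ({x, y, z} : Finset V), X.graph.Adj v w := by
      simp only [Finset.mem_insert, Finset.mem_singleton]
      rintro w (rfl | rfl | rfl)
      exacts [sxy.ab, sxy.ad, syz.ad]
    convert hX v (mem_vertices_left sxy.ab) {x, y, z} adj ?_
    intro a ha b hb hab
    refine ⟨?_, ?_⟩
    · intro w hw
      simp only [Finset.mem_insert, Finset.mem_singleton] at hw
      rcases hw with rfl | rfl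
      · exact adj _ ha
      · exact adj _ hb
    · simp only [Finset.mem_insert, Finset.mem_singleton] at ha hb
      have h1 := sxy.mem
      have h2 := syz.mem
      have h3 := sxz.mem
      rcases ha with rfl | rfl | rfl <;> rcases hb with rfl | rfl | rfl <;>
        first
        | exact absurd rfl hab
        | exact ⟨_, h1, by simp, by intro w; simp; tauto⟩
        | exact ⟨_, h2, by simp, by intro w; simp; tauto⟩
        | exact ⟨_, h3, by simp, by intro w; simp; tauto⟩
  obtain ⟨C, hC, hvC, hs⟩ := hsimp.2
  obtain ⟨n, φ, hφ, rfl⟩ := X.exists_chart C hC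
  obtain ⟨o, rfl⟩ := hvC
  obtain ⟨x', rfl⟩ := hs (by simp : x ∈ _)
  obtain ⟨y', rfl⟩ := hs (by simp : y ∈ _)
  obtain ⟨z', rfl⟩ := hs (by simp : z ∈ _)
  obtain ⟨i, rfl⟩ := eq_flip_of_adj hφ sxy.ab
  obtain ⟨j, rfl⟩ := eq_flip_of_adj hφ sxy.ad
  obtain ⟨k, rfl⟩ := eq_flip_of_adj hφ syz.ad
  have hij : i ≠ j := fun h => sxy.bd (by rw [h])
  have hjk : j ≠ k := fun h => syz.bd (by rw [h])
  have hik : i ≠ k := fun h => sxz.bd (by rw [h])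
  obtain rfl : p = φ (flip (flip o i) j) :=
    sxy.unique_opposite (isSquare_flip hφ o hij)
  obtain rfl : q = φ (flip (flip o j) k) :=
    syz.unique_opposite (isSquare_flip hφ o hjk)
  obtain rfl : r = φ (flip (flip o i) k) :=
    sxz.unique_opposite (isSquare_flip hφ o hik)
  refine ⟨φ (flip (flip (flip o i) j) k), isSquare_flip hφ _ hjk, ?_, ?_⟩
  · rw [flip_comm o i j]
    exact isSquare_flip hφ _ hik
  · rw [flip_comm (flip o i) j k, flip_comm o i k, flip_comm o j k, flip_comm (flip o k) i j]
    exact isSquare_flip hφ _ hij.symm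

end CubeComplex

namespace CubeComplex

variable {V : Type*} {X : CubeComplex V}

open SimpleGraph (Walk)

/-! ### Normal forms of edge paths -/

/-- Edge paths that differ by pushing them across `2`-cubes. -/
inductive Swap (X : CubeComplex V) : ∀ {u v : V}, X.graph.Walk u v → X.graph.Walk u v → Prop
  | refl {u v : V} (p : X.graph.Walk u v) : Swap X p p
  | symm {u v : V} {p q : X.graph.Walk u v} : Swap X p q → Swap X q p
  | trans {u v : V} {p q r : X.graph.Walk u v} : Swap X p q → Swap X q r → Swap X p r
  | cons {u v w : V} (h : X.graph.Adj u v) {p q : X.graph.Walk v w} :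
      Swap X p q → Swap X (Walk.cons h p) (Walk.cons h q)
  | square {a b c d w : V} (s : X.IsSquare a b c d) (p : X.graph.Walk c w) :
      Swap X (Walk.cons s.ab (Walk.cons s.bc p)) (Walk.cons s.ad (Walk.cons s.dc p))

theorem Swap.length_eq {u v : V} {p q : X.graph.Walk u v} (h : X.Swap p q) :
    p.length = q.length := by
  induction h with
  | refl => rfl
  | symm _ ih => exact ih.symm
  | trans _ _ ih ih' => exact ih.trans ih'
  | cons _ _ ih => simp [ih]
  | square => simp

/-- How the first edges of two swap-equivalent edge paths are related. -/
inductive HeadRel (X : CubeComplex V) : ∀ {u v : V}, X.graph.Walk u v → X.graph.Walk u v → Prop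
  | nil {v : V} : HeadRel X (Walk.nil : X.graph.Walk v v) Walk.nil
  | same {u v w : V} (h : X.graph.Adj u v) {p q : X.graph.Walk v w} :
      X.Swap p q → HeadRel X (Walk.cons h p) (Walk.cons h q)
  | square {a b c d w : V} (s : X.IsSquare a b c d) {p : X.graph.Walk b w} {q : X.graph.Walk d w}
      (r : X.graph.Walk c w) : X.Swap p (Walk.cons s.bc r) → X.Swap q (Walk.cons s.dc r) →
      HeadRel X (Walk.cons s.ab p) (Walk.cons s.ad q)

theorem HeadRel.refl {u v : V} (p : X.graph.Walk u v) : X.HeadRel p p := by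
  cases p with
  | nil => exact .nil
  | cons h p => exact .same h (.refl p)

theorem HeadRel.symm {u v : V} {p q : X.graph.Walk u v} (h : X.HeadRel p q) : X.HeadRel q p := by
  cases h with
  | nil => exact .nil
  | same h hs => exact .same h hs.symm
  | square s r h1 h2 => exact .square s.reflect r h2 h1

/-- The only place where swaps use the flag condition. When both relations are given by squares, the
two tails of `q` are compared by induction on length. If they start with the same edge, the squares
coincide. Otherwise three squares meet pairwise along edges at the second vertex of `q`, and the far
faces of the 3-cube they span relate `p` to `r`. -/
theorem HeadRel.trans (hX : X.HasFlagLinks) {n : ℕ}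
    (ih : ∀ {u v : V} {p q : X.graph.Walk u v}, p.length < n → X.Swap p q → X.HeadRel p q)
    {u v : V} {p q r : X.graph.Walk u v} (hn : q.length ≤ n) (hpq : X.HeadRel p q)
    (hqr : X.HeadRel q r) : X.HeadRel p r := by
  cases hpq with
  | nil => exact hqr
  | same h hs =>
    cases hqr with
    | same _ hs' => exact .same h (hs.trans hs')
    | square s r h1 h2 => exact .square s r (hs.trans h1) h2
  | square s r h1 h2 =>
    cases hqr with
    | same _ hs' => exact .square s r h1 (hs'.symm.trans h2)
    | square s' r' h1' h2' =>
      have hlen := h2.length_eq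
      simp only [Walk.length_cons] at hlen hn
      have hh := ih (by simp only [Walk.length_cons]; omega) (h2.symm.trans h1')
      generalize_proofs e1 e2 at hh
      cases hh with
      | same _ hr =>
        obtain rfl := s.reflect.unique s'
        exact .same _ ((h1.trans (.cons _ hr)).trans h2'.symm)
      | square t y g1 g2 =>
        obtain ⟨w, t1, t2, t3⟩ := hX.exists_cube s.rotate.rotate.rotate t s'.rotate.reflect
        refine .square t1 (Walk.cons t2.dc.symm.symm.symm y) ?_ ?_
        · exact (h1.trans (.cons _ g1)).trans (.square t2.rotate.reflect y)
        · exact (h2'.trans (.cons _ g2)).trans (.square t3.rotate.rotate.rotate y)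

theorem Swap.headRel (hX : X.HasFlagLinks) {u v : V} {p q : X.graph.Walk u v} (h : X.Swap p q) :
    X.HeadRel p q := by
  suffices H : ∀ n : ℕ, ∀ {u v : V} {p q : X.graph.Walk u v}, p.length < n → X.Swap p q →
      X.HeadRel p q from H _ (Nat.lt_succ_self _) h
  intro n
  induction n with
  | zero => intro _ _ _ _ h; omega
  | succ n ih =>
    intro u v p q hn h
    clear * - ih hn h hX
    induction h with
    | refl p => exact .refl p
    | @symm _ _ p _ hpq ih' =>
      rw [← hpq.length_eq] at hn
      exact (ih' hn).symm
    | @trans _ _ p _ _ hpq _ ih1 ih2 =>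
      have hq := hpq.length_eq ▸ hn
      exact HeadRel.trans hX ih (Nat.le_of_lt_succ hq) (ih1 hn) (ih2 hq)
    | cons h hs => exact .same h hs
    | square s p => exact .square s p (.refl _) (.refl _)

theorem Swap.cons_inv (hX : X.HasFlagLinks) {u v w x : V} {h : X.graph.Adj u v}
    {h' : X.graph.Adj u w} {p : X.graph.Walk v x} {q : X.graph.Walk w x}
    (hs : X.Swap (Walk.cons h p) (Walk.cons h' q)) :
    (∃ e : w = v, X.Swap p (q.copy e rfl)) ∨
      ∃ (c : V) (s : X.IsSquare u v c w) (r : X.graph.Walk c x),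
        X.Swap p (Walk.cons s.bc r) ∧ X.Swap q (Walk.cons s.dc r) := by
  have := hs.headRel hX
  cases this with
  | same _ h => exact .inl ⟨rfl, h⟩
  | square s r h1 h2 => exact .inr ⟨_, s, r, h1, h2⟩

theorem Swap.cancel (hX : X.HasFlagLinks) {u v x : V} {h : X.graph.Adj u v}
    {p q : X.graph.Walk v x} (hs : X.Swap (Walk.cons h p) (Walk.cons h q)) : X.Swap p q := by
  rcases hs.cons_inv hX with ⟨_, h⟩ | ⟨c, s, _⟩
  · exact h
  · exact absurd rfl s.bd

/-- The edge path traverses some edge back and forth in direct succession. -/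
inductive HasBacktrack (X : CubeComplex V) : ∀ {u v : V}, X.graph.Walk u v → Prop
  | here {u v w : V} (h : X.graph.Adj u v) (p : X.graph.Walk u w) :
      HasBacktrack X (Walk.cons h (Walk.cons h.symm p))
  | cons {u v w : V} (h : X.graph.Adj u v) {p : X.graph.Walk v w} :
      HasBacktrack X p → HasBacktrack X (Walk.cons h p)

/-- No edge path swap-equivalent to `p` has a backtrack. -/
def IsReduced (X : CubeComplex V) {u v : V} (p : X.graph.Walk u v) : Prop :=
  ∀ q, X.Swap p q → ¬ X.HasBacktrack q

theorem IsReduced.of_swap {u v : V} {p q : X.graph.Walk u v} (hp : X.IsReduced p)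
    (h : X.Swap p q) : X.IsReduced q := fun r hr => hp r (h.trans hr)

theorem IsReduced.tail {u v w : V} {h : X.graph.Adj u v} {p : X.graph.Walk v w}
    (hp : X.IsReduced (Walk.cons h p)) : X.IsReduced p :=
  fun q hq hb => hp _ (.cons h hq) (.cons h hb)

theorem isReduced_nil (v : V) : X.IsReduced (Walk.nil : X.graph.Walk v v) := by
  intro _ hq hb
  have := hq.length_eq
  cases hb <;> simp at this

theorem isReduced_of_length_eq_dist {u v : V} {p : X.graph.Walk u v}
    (hp : p.length = X.graph.dist u v) : X.IsReduced p := by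
  have key : ∀ {u v : V} {q : X.graph.Walk u v}, X.HasBacktrack q →
      ∃ r : X.graph.Walk u v, r.length < q.length := by
    intro u v q hq
    induction hq with
    | here h p => exact ⟨p, by simp only [Walk.length_cons]; omega⟩
    | cons h _ ih =>
      obtain ⟨r, hr⟩ := ih
      exact ⟨Walk.cons h r, by simpa using hr⟩
  intro q hq hb
  obtain ⟨r, hr⟩ := key hb
  have := SimpleGraph.dist_le r
  rw [← hq.length_eq] at hr
  omega

/-- If a reduced edge path stops being reduced when the edge `h` is put in front, then it is
swap-equivalent to a path starting with the reverse of `h`. -/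
theorem IsReduced.exists_of_not_cons (hX : X.HasFlagLinks) {u v w : V} {p : X.graph.Walk v w}
    (hp : X.IsReduced p) (h : X.graph.Adj u v) (hn : ¬ X.IsReduced (Walk.cons h p)) :
    ∃ r : X.graph.Walk u w, X.Swap p (Walk.cons h.symm r) := by
  induction hl : p.length using Nat.strong_induction_on generalizing u v p with
  | _ n ih =>
    simp only [IsReduced, not_forall, not_not] at hn
    obtain ⟨q, hq, hb⟩ := hn
    cases hb with
    | here h' q =>
      rcases hq.cons_inv hX with ⟨rfl, h1⟩ | ⟨c, s, r, h1, h2⟩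
      · exact ⟨_, h1⟩
      -- If the backtrack starts with another edge, uniqueness of squares makes `r` start by
      -- returning along `s.bc`, so `p` itself is equivalent to a path with a backtrack.
      · exfalso
        rcases h2.cons_inv hX with ⟨e, -⟩ | ⟨y, t, z, g1, g2⟩
        · exact s.ac e.symm
        · obtain rfl := t.unique_opposite s.rotate.rotate.rotate
          exact hp _ (h1.trans (.cons _ g2)) (.here _ _)
    | @cons _ v' _ h' q hb =>
      rcases hq.cons_inv hX with ⟨rfl, h1⟩ | ⟨c, s, r, h1, h2⟩
      · exact absurd hb (hp _ h1)
      · have hr : X.IsReduced r := (hp.of_swap h1).tail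
        have hlen := h1.length_eq
        rw [Walk.length_cons] at hlen
        -- The backtrack lies further on: the square `s` moves the problem from `p` to the shorter
        -- path `r`, and carries the answer back.
        obtain ⟨t, ht⟩ := ih r.length (by omega) hr s.dc
          (fun H => H _ h2.symm hb) rfl
        exact ⟨_, (h1.trans (.cons _ ht)).trans (.square s.rotate.reflect.reflect t)⟩

/-- Put the edge `h` in front of the reduced edge path `p` and reduce the result to `r`. -/
def Act (X : CubeComplex V) {u v w : V} (h : X.graph.Adj u v) (p : X.graph.Walk v w)
    (r : X.graph.Walk u w) : Prop :=
  (X.Swap r (Walk.cons h p) ∧ X.IsReduced r) ∨ X.Swap p (Walk.cons h.symm r)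

/-! ### The action of edges on reduced paths -/

namespace Act

variable {u v w : V} {h : X.graph.Adj u v} {p p' : X.graph.Walk v w} {r r' : X.graph.Walk u w}

theorem exists_of_isReduced (hX : X.HasFlagLinks) (h : X.graph.Adj u v) (hp : X.IsReduced p) :
    ∃ r, X.Act h p r := by
  by_cases hr : X.IsReduced (Walk.cons h p)
  · exact ⟨_, .inl ⟨.refl _, hr⟩⟩
  · obtain ⟨r, hr⟩ := hp.exists_of_not_cons hX h hr
    exact ⟨r, .inr hr⟩

theorem isReduced (ha : X.Act h p r) (hp : X.IsReduced p) : X.IsReduced r := by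
  rcases ha with ⟨_, hr⟩ | hs
  · exact hr
  · exact (hp.of_swap hs).tail

theorem congr_left (ha : X.Act h p r) (hs : X.Swap p p') : X.Act h p' r := by
  rcases ha with ⟨h1, h2⟩ | h1
  · exact .inl ⟨h1.trans (.cons h hs), h2⟩
  · exact .inr (hs.symm.trans h1)

theorem congr_right (ha : X.Act h p r) (hs : X.Swap r r') : X.Act h p r' := by
  rcases ha with ⟨h1, h2⟩ | h1
  · exact .inl ⟨hs.symm.trans h1, h2.of_swap hs⟩
  · exact .inr (h1.trans (.cons _ hs))

theorem inv (ha : X.Act h p r) (hp : X.IsReduced p) : X.Act h.symm r p := by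
  rcases ha with ⟨h1, h2⟩ | h1
  · exact .inr h1
  · exact .inl ⟨h1, hp⟩

theorem swap (hX : X.HasFlagLinks) (ha : X.Act h p r) (ha' : X.Act h p r') :
    X.Swap r r' := by
  rcases ha with ⟨h1, h2⟩ | h1 <;> rcases ha' with ⟨h1', h2'⟩ | h1'
  · exact h1.trans h1'.symm
  · exact absurd (.here _ _) (h2 _ (h1.trans (.cons h h1')))
  · exact absurd (.here _ _) (h2' _ (h1'.trans (.cons h h1)))
  · exact (h1.symm.trans h1').cancel hX

/-- The action respects the square relation. Together with `Act.inv` for backtracks and `Act.swap`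
for uniqueness, this is what makes normal forms homotopy invariant. -/
theorem square (hX : X.HasFlagLinks) {a b c d w : V} (s : X.IsSquare a b c d)
    {n : X.graph.Walk c w} {r₁ : X.graph.Walk b w} {r₂ : X.graph.Walk a w} (hn : X.IsReduced n)
    (h₁ : X.Act s.bc n r₁) (h₂ : X.Act s.ab r₁ r₂) :
    ∃ r : X.graph.Walk d w, X.Act s.dc n r ∧ X.Act s.ad r r₂ := by
  rcases h₁ with ⟨h1, h1'⟩ | h1
  · rcases h₂ with ⟨h2, h2'⟩ | h2
    · have hs : X.Swap r₂ (Walk.cons s.ad (Walk.cons s.dc n)) :=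
        (h2.trans (.cons _ h1)).trans (.square s n)
      exact ⟨_, .inl ⟨.refl _, (h2'.of_swap hs).tail⟩, .inl ⟨hs, h2'⟩⟩
    · rcases (h2.symm.trans h1).cons_inv hX with ⟨e, -⟩ | ⟨y, t, r, g1, g2⟩
      · exact absurd e.symm s.ac
      · obtain rfl := t.unique_opposite s.rotate.reflect
        exact ⟨r, .inr g2, .inl ⟨g1, (h1'.of_swap h2).tail⟩⟩
  · rcases h₂ with ⟨h2, h2'⟩ | h2
    · obtain ⟨r, hr⟩ := exists_of_isReduced hX s.dc hn
      refine ⟨r, hr, ?_⟩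
      rcases hr with ⟨g1, g1'⟩ | g1
      · refine .inr (g1.trans ((Swap.cons _ h1).trans ?_))
        exact (Swap.square s.rotate.rotate.rotate.reflect r₁).trans (.cons _ h2.symm)
      · rcases (h1.symm.trans g1).cons_inv hX with ⟨e, -⟩ | ⟨y, t, x, k1, k2⟩
        · exact absurd e.symm s.bd
        · obtain rfl := t.unique_opposite s.rotate.rotate.reflect
          exact absurd (.here _ _) (h2' _ (h2.trans (.cons _ k1)))
    · refine ⟨Walk.cons s.ad.symm r₂, .inr ?_, .inr (.refl _)⟩
      exact (h1.trans (.cons _ h2)).trans (.square s.rotate.rotate.reflect r₂)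

end Act

/-- `r` is a normal form of the edge path `p`: it is obtained by adding the edges of `p` one by one,
reducing at each step. -/
def NormalForm (X : CubeComplex V) :
    ∀ {u v : V}, X.graph.Walk u v → X.graph.Walk u v → Prop
  | _, _, Walk.nil, r => X.Swap r Walk.nil
  | _, _, Walk.cons h p, r => ∃ q, NormalForm X p q ∧ X.Act h q r

namespace NormalForm

variable {u v : V} {p q r r' : X.graph.Walk u v}

theorem congr_right (h : X.NormalForm p r) (hs : X.Swap r r') : X.NormalForm p r' := by
  cases p with
  | nil => exact Swap.trans hs.symm h
  | cons e p =>
    obtain ⟨q, hq, ha⟩ := h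
    exact ⟨q, hq, ha.congr_right hs⟩

theorem isReduced (h : X.NormalForm p r) : X.IsReduced r := by
  induction p with
  | nil => exact (isReduced_nil _).of_swap (Swap.symm h)
  | cons e p ih =>
    obtain ⟨q, hq, ha⟩ := h
    exact ha.isReduced (ih hq)

theorem swap (hX : X.HasFlagLinks) (h : X.NormalForm p r) (h' : X.NormalForm p r') :
    X.Swap r r' := by
  induction p with
  | nil => exact Swap.trans h (Swap.symm h')
  | cons e p ih =>
    obtain ⟨q, hq, ha⟩ := h
    obtain ⟨q', hq', ha'⟩ := h'
    exact ha.swap hX (ha'.congr_left (ih hq' hq))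

theorem self_of_isReduced (hp : X.IsReduced p) : X.NormalForm p p := by
  induction p with
  | nil => exact Swap.refl _
  | cons e p ih => exact ⟨p, ih hp.tail, .inl ⟨.refl _, hp⟩⟩

theorem iff_of_homotopic (hX : X.HasFlagLinks) (h : X.Homotopic p q) :
    X.NormalForm p r ↔ X.NormalForm q r := by
  induction h with
  | refl => rfl
  | symm _ ih => exact ih.symm
  | trans _ _ ih ih' => exact ih.trans ih'
  | cons e _ ih => exact exists_congr fun q => and_congr_left fun _ => ih
  | backtrack e p =>
    constructor
    · rintro ⟨q, ⟨q', hq', ha⟩, ha'⟩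
      exact hq'.congr_right ((ha.inv hq'.isReduced).swap hX ha')
    · intro hr
      obtain ⟨q, hq⟩ := Act.exists_of_isReduced hX e.symm hr.isReduced
      exact ⟨q, ⟨r, hr, hq⟩, hq.inv hr.isReduced⟩
  | square s p =>
    constructor
    · rintro ⟨q, ⟨q', hq', ha⟩, ha'⟩
      obtain ⟨t, ht, ht'⟩ := Act.square hX s hq'.isReduced ha ha'
      exact ⟨t, ⟨q', hq', ht⟩, ht'⟩
    · rintro ⟨q, ⟨q', hq', ha⟩, ha'⟩
      obtain ⟨t, ht, ht'⟩ := Act.square hX s.reflect hq'.isReduced ha ha'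
      exact ⟨t, ⟨q', hq', ht⟩, ht'⟩

end NormalForm

theorem Homotopic.append_right {u v w : V} {p q : X.graph.Walk u v} (h : X.Homotopic p q)
    (r : X.graph.Walk v w) : X.Homotopic (p.append r) (q.append r) := by
  induction h with
  | refl => exact .refl _
  | symm _ ih => exact (ih r).symm
  | trans _ _ ih ih' => exact (ih r).trans (ih' r)
  | cons e _ ih => exact .cons e (ih r)
  | backtrack e p => exact .backtrack e _
  | square s p => exact .square s _

theorem Homotopic.append_left {u v w : V} (r : X.graph.Walk u v) {p q : X.graph.Walk v w}
    (h : X.Homotopic p q) : X.Homotopic (r.append p) (r.append q) := by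
  induction r with
  | nil => exact h
  | cons e r ih => exact .cons e (ih h)

theorem homotopic_reverse_append {u v : V} (p : X.graph.Walk u v) :
    X.Homotopic (p.reverse.append p) Walk.nil := by
  induction p with
  | nil => exact .refl _
  | cons e p ih =>
    rw [Walk.reverse_cons, ← Walk.append_assoc]
    exact (Homotopic.append_left _ (.backtrack e.symm p)).trans ih

theorem IsSimplyConnected.homotopic (hX : X.IsSimplyConnected) {u v : V} (hu : u ∈ X.vertices)
    (p q : X.graph.Walk u v) : X.Homotopic p q := by
  have h1 := (hX.null_homotopic u hu (p.append q.reverse)).append_right q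
  rw [← Walk.append_assoc] at h1
  have h2 := Homotopic.append_left p (homotopic_reverse_append q)
  rw [Walk.append_nil] at h2
  exact h2.symm.trans h1

/-- In a CAT(0) cube complex, reduced edge paths with the same endpoints differ by pushing them
across squares. -/
theorem IsCAT0.swap (hX : X.IsCAT0) {u v : V} (hu : u ∈ X.vertices) {p q : X.graph.Walk u v}
    (hp : X.IsReduced p) (hq : X.IsReduced q) : X.Swap p q :=
  ((NormalForm.iff_of_homotopic hX.flag (hX.simplyConnected.homotopic hu p q)).1
    (.self_of_isReduced hp)).swap hX.flag (.self_of_isReduced hq)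

end CubeComplex

namespace CubeComplex

variable {V : Type*} {X : CubeComplex V}

open SimpleGraph (Walk)

/-! ### Distances in the `1`-skeleton -/

section Distance

theorem IsCAT0.reachable (hX : X.IsCAT0) {u v : V} (hu : u ∈ X.vertices) (hv : v ∈ X.vertices) :
    X.graph.Reachable u v := hX.simplyConnected.reachable u hu v hv

theorem IsCAT0.dist_triangle (hX : X.IsCAT0) {u v w : V} (hu : u ∈ X.vertices)
    (hv : v ∈ X.vertices) (hw : w ∈ X.vertices) :
    X.graph.dist u w ≤ X.graph.dist u v + X.graph.dist v w := by
  obtain ⟨p, hp⟩ := (hX.reachable hu hv).exists_walk_length_eq_dist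
  obtain ⟨q, hq⟩ := (hX.reachable hv hw).exists_walk_length_eq_dist
  rw [← hp, ← hq, ← Walk.length_append]
  exact SimpleGraph.dist_le _

theorem IsCAT0.dist_eq_zero (hX : X.IsCAT0) {u v : V} (hu : u ∈ X.vertices)
    (hv : v ∈ X.vertices) : X.graph.dist u v = 0 ↔ u = v :=
  (hX.reachable hu hv).dist_eq_zero_iff

theorem IsCAT0.dist_le_succ (hX : X.IsCAT0) {a b v : V} (h : X.graph.Adj a b)
    (hv : v ∈ X.vertices) : X.graph.dist v b ≤ X.graph.dist v a + 1 := by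
  have := hX.dist_triangle hv (mem_vertices_left h) (mem_vertices_right h)
  rwa [SimpleGraph.dist_eq_one_iff_adj.2 h] at this

/-- Put the edge from `b` to `a` in front of a geodesic from `a` to `v`. If the result is reduced,
it has the length of a geodesic from `b`, one more than `dist a v`; if not, the geodesic from `a`
can be swapped to pass through `b` first. -/
theorem IsCAT0.dist_ne (hX : X.IsCAT0) {a b v : V} (h : X.graph.Adj a b) (hv : v ∈ X.vertices) :
    X.graph.dist v a ≠ X.graph.dist v b := by
  intro he
  rw [SimpleGraph.dist_comm, SimpleGraph.dist_comm (u := v)] at he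
  have ha := mem_vertices_left h
  have hb := mem_vertices_right h
  obtain ⟨p, hp⟩ := (hX.reachable ha hv).exists_walk_length_eq_dist
  obtain ⟨q, hq⟩ := (hX.reachable hb hv).exists_walk_length_eq_dist
  have hp' := isReduced_of_length_eq_dist hp
  by_cases hr : X.IsReduced (Walk.cons h.symm p)
  · have := (hX.swap hb hr (isReduced_of_length_eq_dist hq)).length_eq
    rw [Walk.length_cons] at this
    omega
  · obtain ⟨r, hr⟩ := hp'.exists_of_not_cons hX.flag h.symm hr
    have h1 := hr.length_eq
    have h2 := SimpleGraph.dist_le r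
    rw [Walk.length_cons] at h1
    omega

theorem IsCAT0.dist_adj (hX : X.IsCAT0) {a b v : V} (h : X.graph.Adj a b) (hv : v ∈ X.vertices) :
    X.graph.dist v b = X.graph.dist v a + 1 ∨ X.graph.dist v a = X.graph.dist v b + 1 := by
  have h1 := hX.dist_le_succ h hv
  have h2 := hX.dist_le_succ h.symm hv
  have h3 := hX.dist_ne h hv
  omega

/-- The quadrangle condition. -/
theorem IsCAT0.quadrangle (hX : X.IsCAT0) {v a b z : V} (ha : X.graph.Adj v a)
    (hb : X.graph.Adj v b) (hab : a ≠ b) (hz : z ∈ X.vertices)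
    (hda : X.graph.dist z v = X.graph.dist z a + 1)
    (hdb : X.graph.dist z v = X.graph.dist z b + 1) :
    ∃ c, X.IsSquare v a c b ∧ X.graph.dist z a = X.graph.dist z c + 1 := by
  have hv := mem_vertices_left ha
  obtain ⟨p, hp⟩ := (hX.reachable (mem_vertices_right ha) hz).exists_walk_length_eq_dist
  obtain ⟨q, hq⟩ := (hX.reachable (mem_vertices_right hb) hz).exists_walk_length_eq_dist
  simp only [SimpleGraph.dist_comm (u := z)] at *
  have hp' : (Walk.cons ha p).length = X.graph.dist v z := by rw [Walk.length_cons]; omega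
  have hq' : (Walk.cons hb q).length = X.graph.dist v z := by rw [Walk.length_cons]; omega
  rcases (hX.swap hv (isReduced_of_length_eq_dist hp')
    (isReduced_of_length_eq_dist hq')).cons_inv hX.flag with ⟨e, -⟩ | ⟨c, s, r, h1, -⟩
  · exact absurd e.symm hab
  · refine ⟨c, s, ?_⟩
    have h2 := h1.length_eq
    have h3 := SimpleGraph.dist_le r
    have h4 := hX.dist_le_succ s.bc.symm hz
    simp only [SimpleGraph.dist_comm (u := z)] at h4
    rw [Walk.length_cons] at h2
    omega

theorem IsCAT0.exists_adj_dist (hX : X.IsCAT0) {u v : V} (hu : u ∈ X.vertices)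
    (hv : v ∈ X.vertices) (hne : u ≠ v) :
    ∃ w, X.graph.Adj u w ∧ X.graph.dist v u = X.graph.dist v w + 1 := by
  obtain ⟨p, hp⟩ := (hX.reachable hu hv).exists_walk_length_eq_dist
  cases p with
  | nil => exact absurd rfl hne
  | cons h p =>
    refine ⟨_, h, ?_⟩
    have h1 := SimpleGraph.dist_le p
    have h2 := hX.dist_le_succ h.symm hv
    simp only [SimpleGraph.dist_comm (u := v)] at *
    rw [Walk.length_cons] at hp
    omega

end Distance

/-! ### Halfspaces and convex sets of vertices -/

/-- The vertices that are closer to `a` than to `b`. -/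
def halfspace (X : CubeComplex V) (a b : V) : Set V :=
  {v | v ∈ X.vertices ∧ X.graph.dist v a < X.graph.dist v b}

/-- A set of vertices that contains every geodesic between two of its elements. -/
structure IsConvexSet (X : CubeComplex V) (Y : Set V) : Prop where
  subset : Y ⊆ X.vertices
  between : ∀ u ∈ Y, ∀ v ∈ Y, ∀ w ∈ X.vertices,
    X.graph.dist u w + X.graph.dist w v = X.graph.dist u v → w ∈ Y

theorem IsConvexSet.inter {Y Z : Set V} (hY : X.IsConvexSet Y) (hZ : X.IsConvexSet Z) :
    X.IsConvexSet (Y ∩ Z) where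
  subset := Set.inter_subset_left.trans hY.subset
  between u hu v hv w hw h :=
    ⟨hY.between u hu.1 v hv.1 w hw h, hZ.between u hu.2 v hv.2 w hw h⟩

theorem isConvexSet_vertices : X.IsConvexSet X.vertices := ⟨subset_rfl, fun _ _ _ _ _ hw _ => hw⟩

/-- The full subcomplex on a set of vertices. -/
def restrict (X : CubeComplex V) (Y : Set V) : CubeComplex V where
  cubes := {C | C ∈ X.cubes ∧ C ⊆ Y}
  exists_chart := by
    rintro C ⟨hC, hCY⟩
    obtain ⟨n, φ, ⟨hi, hφ⟩, rfl⟩ := X.exists_chart C hC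
    refine ⟨n, φ, ⟨hi, fun D hD => ?_⟩, rfl⟩
    rw [← hφ D hD]
    exact ⟨fun h => h.1, fun h => ⟨h, hD.trans hCY⟩⟩
  inter_mem := fun C hC D hD h => ⟨X.inter_mem C hC.1 D hD.1 h, Set.inter_subset_left.trans hC.2⟩

theorem restrict_adj {Y : Set V} {a b : V} :
    (X.restrict Y).graph.Adj a b ↔ X.graph.Adj a b ∧ a ∈ Y ∧ b ∈ Y := by
  simp only [graph, restrict, Set.mem_ofPred_eq, Set.insert_subset_iff, Set.singleton_subset_iff]
  tauto

theorem restrict_isSquare {Y : Set V} {a b c d : V} :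
    (X.restrict Y).IsSquare a b c d ↔ X.IsSquare a b c d ∧ a ∈ Y ∧ b ∈ Y ∧ c ∈ Y ∧ d ∈ Y := by
  constructor
  · intro s
    have h := s.mem.2
    simp only [Set.insert_subset_iff, Set.singleton_subset_iff] at h
    exact ⟨⟨s.mem.1, (restrict_adj.1 s.ab).1, (restrict_adj.1 s.bc).1, (restrict_adj.1 s.ad).1,
      (restrict_adj.1 s.dc).1, s.ac, s.bd⟩, h⟩
  · rintro ⟨s, ha, hb, hc, hd⟩
    exact ⟨⟨s.mem, by simp [Set.insert_subset_iff, *]⟩, restrict_adj.2 ⟨s.ab, ha, hb⟩,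
      restrict_adj.2 ⟨s.bc, hb, hc⟩, restrict_adj.2 ⟨s.ad, ha, hd⟩, restrict_adj.2 ⟨s.dc, hd, hc⟩,
      s.ac, s.bd⟩

theorem restrict_vertices {Y : Set V} (hY : Y ⊆ X.vertices) : (X.restrict Y).vertices = Y := by
  ext v
  simp only [vertices, restrict, Set.mem_ofPred_eq, Set.singleton_subset_iff]
  exact ⟨fun h => h.2, fun h => ⟨hY h, h⟩⟩

section Halfspace

variable {a b c d x y v : V}

theorem halfspace_subset : X.halfspace a b ⊆ X.vertices := fun _ h => h.1

theorem left_mem_halfspace (h : X.graph.Adj a b) : a ∈ X.halfspace a b :=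
  ⟨mem_vertices_left h, by simp [SimpleGraph.dist_eq_one_iff_adj.2 h]⟩

theorem not_mem_halfspace_symm (h : v ∈ X.halfspace a b) : v ∉ X.halfspace b a :=
  fun h' => lt_asymm h.2 h'.2

theorem right_not_mem_halfspace : b ∉ X.halfspace a b := fun h => by simpa using h.2

variable (hX : X.IsCAT0)
include hX

theorem mem_halfspace_symm (h : X.graph.Adj a b) (hv : v ∈ X.vertices) :
    v ∈ X.halfspace b a ↔ v ∉ X.halfspace a b := by
  have := hX.dist_ne h hv
  simp only [halfspace, Set.mem_ofPred_eq, hv, true_and]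
  omega

theorem halfspace_symm (h : X.graph.Adj a b) :
    X.halfspace b a = X.vertices \ X.halfspace a b := by
  ext v
  constructor
  · exact fun hv => ⟨hv.1, (mem_halfspace_symm hX h hv.1).1 hv⟩
  · exact fun hv => (mem_halfspace_symm hX h hv.1).2 hv.2

/-- If `v` were on the `a` side of `a b` but on the `c` side of `d c`, then `a` and `c` would both
be nearer to `v` than `b`. The quadrangle condition then puts the fourth vertex `d` nearer than `a`,
a contradiction. -/
theorem IsSquare.halfspace_subset (s : X.IsSquare a b c d) :
    X.halfspace a b ⊆ X.halfspace d c := by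
  rintro v ⟨hv, hlt⟩
  refine ⟨hv, ?_⟩
  by_contra hcd
  have h1 := hX.dist_adj s.ab hv
  have h2 := hX.dist_adj s.bc hv
  have h3 := hX.dist_adj s.ad hv
  have h4 := hX.dist_adj s.dc hv
  obtain ⟨e, t, he⟩ := hX.quadrangle s.ab.symm s.bc s.ac hv (by omega) (by omega)
  obtain rfl := t.unique_opposite s.reflect.rotate.rotate.rotate
  omega

theorem IsSquare.halfspace_eq (s : X.IsSquare a b c d) : X.halfspace a b = X.halfspace d c :=
  (s.halfspace_subset hX).antisymm (IsSquare.halfspace_subset hX s.rotate.rotate.rotate.reflect)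

/-- An edge of a convex subcomplex that crosses the hyperplane dual to another edge of the
subcomplex is dual to the same hyperplane of the subcomplex. -/
theorem eqvGen_opposite_of_crossing {Y : Set V} (hY : X.IsConvexSet Y) (ha : a ∈ Y) (hb : b ∈ Y)
    (hx : x ∈ Y) (hy : y ∈ Y) (hab : X.graph.Adj a b) (hxy : X.graph.Adj x y)
    (hxa : x ∈ X.halfspace a b) (hyb : y ∉ X.halfspace a b) :
    Relation.EqvGen (X.restrict Y).Opposite s(a, b) s(x, y) ∧
      X.halfspace a b = X.halfspace x y := by
  induction hk : X.graph.dist a x generalizing x y with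
  | zero =>
    have hav := hY.subset ha
    have hbv := hY.subset hb
    obtain rfl := (hX.dist_eq_zero hav hxa.1).1 hk
    have h1 := hX.dist_adj hab (hY.subset hy)
    have h2 := SimpleGraph.dist_eq_one_iff_adj.2 hxy
    have h3 := mt (fun h => And.intro (hY.subset hy) h) hyb
    rw [SimpleGraph.dist_comm] at h2
    obtain rfl := (hX.dist_eq_zero (hY.subset hy) hbv).1 (by omega)
    exact ⟨.refl _, rfl⟩
  | succ k ih =>
    have hav := hY.subset ha
    have hbv := hY.subset hb
    have hxv := hY.subset hx
    have hyv := hY.subset hy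
    have hne : x ≠ a := by
      rintro rfl
      simp at hk
    obtain ⟨x', hxx', hd⟩ := hX.exists_adj_dist hxv hav hne
    have hx'v := mem_vertices_right hxx'
    have hyb' := ((mem_halfspace_symm hX hab hyv).2 hyb).2
    have hxa' := hxa.2
    have hax := hX.dist_adj hab hxv
    have hay := hX.dist_adj hab hyv
    have hax' := hX.dist_adj hab hx'v
    have h1 := hX.dist_adj hxy hav
    have h2 := hX.dist_adj hxy hbv
    have h3 := hX.dist_adj hxx' hbv
    simp only [SimpleGraph.dist_comm (v := a), SimpleGraph.dist_comm (v := b)] at *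
    have hx'y : x' ≠ y := by rintro rfl; omega
    -- Both `x'` and `y` are one step closer to `b` than `x`. The resulting square carries `x y` to
    -- the opposite edge `x' y'`, which still crosses and is nearer to `a`; `x'` and `y'` lie on
    -- geodesics from `a` to `x` and from `b` to `y`, hence in `Y`.
    obtain ⟨y', s, hs⟩ := hX.quadrangle hxx' hxy hx'y hbv (by omega) (by omega)
    have hy'v := mem_vertices_right s.bc
    have hay' := hX.dist_adj hab hy'v
    have h4 := hX.dist_adj s.dc hav
    simp only [SimpleGraph.dist_comm (v := a), SimpleGraph.dist_comm (v := b)] at *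
    have hx'Y : x' ∈ Y := hY.between a ha x hx x' hx'v (by
      have := SimpleGraph.dist_eq_one_iff_adj.2 hxx'.symm
      omega)
    have hy'Y : y' ∈ Y := hY.between b hb y hy y' hy'v (by
      have := SimpleGraph.dist_eq_one_iff_adj.2 s.dc.symm
      omega)
    obtain ⟨g1, g2⟩ := ih hx'Y hy'Y s.bc ⟨hx'v, by
        simp only [SimpleGraph.dist_comm (v := a), SimpleGraph.dist_comm (v := b)]; omega⟩
      (fun h => by
        have := h.2
        simp only [SimpleGraph.dist_comm (v := a), SimpleGraph.dist_comm (v := b)] at this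
        omega) (by omega)
    have t := s.rotate
    refine ⟨g1.trans _ _ _ (.rel _ _ ⟨x', y', y, x, restrict_isSquare.2 ⟨t, hx'Y, hy'Y, hy, hx⟩,
      rfl, rfl⟩), g2.trans (t.halfspace_eq hX)⟩

theorem halfspace_eq_of_crossing (hab : X.graph.Adj a b) (hxy : X.graph.Adj x y)
    (hxa : x ∈ X.halfspace a b) (hyb : y ∉ X.halfspace a b) :
    X.halfspace a b = X.halfspace x y :=
  (eqvGen_opposite_of_crossing hX isConvexSet_vertices (mem_vertices_left hab)
    (mem_vertices_right hab) (mem_vertices_left hxy) (mem_vertices_right hxy) hab hxy hxa hyb).2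

/-- A geodesic towards `v` cannot leave the halfspace: at an exit edge from `u` to `u'` the
halfspace equals `halfspace u u'`, so `v` would be closer to `u` than to `u'`. -/
theorem isConvexSet_halfspace (hab : X.graph.Adj a b) : X.IsConvexSet (X.halfspace a b) where
  subset := halfspace_subset
  between u hu v hv w hw h := by
    induction hk : X.graph.dist w u generalizing u with
    | zero =>
      obtain rfl := (hX.dist_eq_zero hw hu.1).1 hk
      exact hu
    | succ k ih =>
      have hne : u ≠ w := by rintro rfl; simp at hk
      obtain ⟨u', huu', hd⟩ := hX.exists_adj_dist hu.1 hw hne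
      have hu'v := mem_vertices_right huu'
      have h1 := hX.dist_triangle hu'v hw hv.1
      have h2 := hX.dist_adj huu' hv.1
      simp only [SimpleGraph.dist_comm (v := w), SimpleGraph.dist_comm (u := v)] at *
      have hu' : u' ∈ X.halfspace a b := by
        by_contra hn
        have h3 := (halfspace_eq_of_crossing hX hab huu' hu hn ▸ hv).2
        simp only [SimpleGraph.dist_comm (u := v)] at h3
        omega
      exact ih u' hu' (by omega) (by omega)

end Halfspace

end CubeComplex

namespace CubeComplex

variable {V : Type*} {X : CubeComplex V}

open SimpleGraph (Walk)

/-! ### Gates and separation by halfspaces -/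

section Gate

variable {Y : Set V} {u v w : V} (hX : X.IsCAT0)
include hX

/-- A nonempty convex set of vertices contains a gate for every vertex. -/
theorem IsConvexSet.exists_gate (hY : X.IsConvexSet Y) (hne : Y.Nonempty) (hw : w ∈ X.vertices) :
    ∃ p ∈ Y, ∀ q ∈ Y, X.graph.dist w q = X.graph.dist w p + X.graph.dist p q := by
  obtain ⟨p, hp, hmin⟩ : ∃ p ∈ Y, ∀ q ∈ Y, X.graph.dist w p ≤ X.graph.dist w q := by
    obtain ⟨p, hp, h⟩ := WellFounded.has_min (measure (X.graph.dist w)).wf Y hne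
    exact ⟨p, hp, fun q hq => not_lt.1 (h q hq)⟩
  refine ⟨p, hp, fun q hq => ?_⟩
  have hpv := hY.subset hp
  induction hk : X.graph.dist p q using Nat.strong_induction_on generalizing q with
  | _ k ih =>
    have hqv := hY.subset hq
    by_cases hqp : q = p
    · subst hqp; simp at hk; omega
    obtain ⟨q₁, h₁, hd₁⟩ := hX.exists_adj_dist hqv hpv hqp
    have hq₁v := mem_vertices_right h₁
    have hq₁ : q₁ ∈ Y := hY.between p hp q hq q₁ hq₁v (by
      rw [SimpleGraph.dist_eq_one_iff_adj.2 h₁.symm]; omega)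
    have e₁ := ih (k - 1) (by omega) q₁ hq₁ (by omega)
    rcases hX.dist_adj h₁ hw with e | e
    swap
    · omega
    have hq₁p : q₁ ≠ p := by
      rintro rfl
      have := hmin q hq
      omega
    obtain ⟨q₂, h₂, hd₂⟩ := hX.exists_adj_dist hq₁v hpv hq₁p
    have hq₂v := mem_vertices_right h₂
    have hq₂ : q₂ ∈ Y := hY.between p hp q₁ hq₁ q₂ hq₂v (by
      rw [SimpleGraph.dist_eq_one_iff_adj.2 h₂.symm]; omega)
    have e₂ := ih (k - 2) (by omega) q₂ hq₂ (by omega)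
    have hne' : q ≠ q₂ := by rintro rfl; omega
    -- In the bad case `q` is nearer to `w` than `q₁`. The square on `q`, `q₁`, `q₂` gives `x ∈ Y`
    -- for which the gate formula yields `dist p x = dist p q - 3`, although `x` is adjacent to `q`.
    obtain ⟨x, s, hx⟩ := hX.quadrangle h₁.symm h₂ hne' hw (by omega) (by omega)
    have hxv := mem_vertices_right s.bc
    have hq₂q : X.graph.dist q₂ q = 2 := by
      have t₁ := hX.dist_triangle hpv hq₂v hqv
      have t₂ := hX.dist_triangle hq₂v hq₁v hqv
      rw [SimpleGraph.dist_eq_one_iff_adj.2 h₂.symm, SimpleGraph.dist_eq_one_iff_adj.2 h₁.symm]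
        at t₂
      omega
    have hxY : x ∈ Y := hY.between q₂ hq₂ q hq x hxv (by
      rw [SimpleGraph.dist_eq_one_iff_adj.2 s.dc, SimpleGraph.dist_eq_one_iff_adj.2 s.bc.symm, hq₂q])
    have t₁ := hX.dist_le_succ s.dc hpv
    have t₂ := hX.dist_le_succ s.bc.symm hpv
    have e₃ := ih _ (by omega) x hxY rfl
    omega

/-- A vertex outside of a convex set is separated from it by a hyperplane. -/
theorem IsConvexSet.exists_separating (hY : X.IsConvexSet Y) (hne : Y.Nonempty)
    (hw : w ∈ X.vertices) (hwY : w ∉ Y) :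
    ∃ p ∈ Y, ∃ q ∈ X.vertices, X.graph.Adj p q ∧
      X.graph.dist p q + X.graph.dist q w = X.graph.dist p w ∧
      Y ⊆ X.halfspace p q := by
  obtain ⟨p, hp, hg⟩ := hY.exists_gate hX hne hw
  have hpw : p ≠ w := by rintro rfl; exact hwY hp
  obtain ⟨q, hpq, hq⟩ := hX.exists_adj_dist (hY.subset hp) hw hpw
  refine ⟨p, hp, q, mem_vertices_right hpq, hpq, ?_, fun z hz => ⟨hY.subset hz, ?_⟩⟩
  · rw [SimpleGraph.dist_eq_one_iff_adj.2 hpq]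
    simp only [SimpleGraph.dist_comm (v := w)]
    omega
  · have h1 := hg z hz
    have h2 := hX.dist_triangle hw (mem_vertices_right hpq) (hY.subset hz)
    simp only [SimpleGraph.dist_comm (u := z)]
    omega

theorem finite_separating (hu : u ∈ X.vertices) (hv : v ∈ X.vertices) :
    {h | (∃ a b, X.graph.Adj a b ∧ h = X.halfspace a b) ∧ u ∈ h ∧ v ∉ h}.Finite := by
  induction hk : X.graph.dist v u generalizing u with
  | zero =>
    obtain rfl := (hX.dist_eq_zero hv hu).1 hk
    convert Set.finite_empty
    ext h
    simp only [Set.mem_ofPred_eq, Set.mem_empty_iff_false, iff_false]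
    exact fun h => h.2.2 h.2.1
  | succ k ih =>
    have hne : u ≠ v := by rintro rfl; simp at hk
    obtain ⟨w, huw, hd⟩ := hX.exists_adj_dist hu hv hne
    refine ((ih (mem_vertices_right huw) (by omega)).insert (X.halfspace u w)).subset ?_
    rintro h ⟨⟨a, b, hab, rfl⟩, h1, h2⟩
    by_cases hw : w ∈ X.halfspace a b
    · exact .inr ⟨⟨a, b, hab, rfl⟩, hw, h2⟩
    · exact .inl (halfspace_eq_of_crossing hX hab huw h1 hw)

end Gate

/-! ### Hyperplanes of convex subcomplexes -/

/-- The edges between vertices of `Y` that cross the boundary of `h`. -/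
def crossing (X : CubeComplex V) (Y h : Set V) : Set (Sym2 V) :=
  {e | ∃ x ∈ Y, ∃ y ∈ Y, X.graph.Adj x y ∧ x ∈ h ∧ y ∉ h ∧ e = s(x, y)}

theorem mem_crossing {Y h : Set V} {x y : V} : s(x, y) ∈ X.crossing Y h ↔
    x ∈ Y ∧ y ∈ Y ∧ X.graph.Adj x y ∧ (x ∈ h ∧ y ∉ h ∨ y ∈ h ∧ x ∉ h) := by
  constructor
  · rintro ⟨a, ha, b, hb, hab, h1, h2, he⟩
    rcases Sym2.eq_iff.1 he with ⟨rfl, rfl⟩ | ⟨rfl, rfl⟩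
    · exact ⟨ha, hb, hab, .inl ⟨h1, h2⟩⟩
    · exact ⟨hb, ha, hab.symm, .inr ⟨h1, h2⟩⟩
  · rintro ⟨hx, hy, hxy, ⟨h1, h2⟩ | ⟨h1, h2⟩⟩
    · exact ⟨x, hx, y, hy, hxy, h1, h2, rfl⟩
    · exact ⟨y, hy, x, hx, hxy.symm, h1, h2, Sym2.eq_swap⟩

section Hyperplane

variable {Y : Set V} {a b c d : V} (hX : X.IsCAT0)
include hX

theorem crossing_halfspace_symm (hY : Y ⊆ X.vertices) (hab : X.graph.Adj a b) :
    X.crossing Y (X.halfspace b a) = X.crossing Y (X.halfspace a b) := by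
  ext e
  induction e with
  | _ x y =>
    simp only [mem_crossing]
    refine and_congr_right fun hx => and_congr_right fun hy => and_congr_right fun _ => ?_
    rw [mem_halfspace_symm hX hab (hY hx), mem_halfspace_symm hX hab (hY hy)]
    tauto

/-- The translation between the edge-class definition of hyperplanes and halfspaces of `X`: square
moves preserve the crossed boundary, and conversely crossing edges in a convex set are connected by
squares of that set. -/
theorem hyperplane_eq_crossing (hY : X.IsConvexSet Y) (ha : a ∈ Y) (hb : b ∈ Y)
    (hab : X.graph.Adj a b) :
    {e | Relation.EqvGen (X.restrict Y).Opposite s(a, b) e} = X.crossing Y (X.halfspace a b) := by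
  have key : ∀ e e', (X.restrict Y).Opposite e e' →
      e ∈ X.crossing Y (X.halfspace a b) → e' ∈ X.crossing Y (X.halfspace a b) := by
    rintro _ _ ⟨p, q, c, d, s, rfl, rfl⟩ h
    obtain ⟨s, hp, hq, hc, hd⟩ := restrict_isSquare.1 s
    obtain ⟨-, -, hpq, h⟩ := mem_crossing.1 h
    refine mem_crossing.2 ⟨hd, hc, s.dc, ?_⟩
    rcases h with ⟨h1, h2⟩ | ⟨h1, h2⟩
    · left
      rw [halfspace_eq_of_crossing hX hab hpq h1 h2, s.halfspace_eq hX]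
      exact ⟨left_mem_halfspace s.dc, right_not_mem_halfspace⟩
    · right
      rw [halfspace_eq_of_crossing hX hab hpq.symm h1 h2,
        IsSquare.halfspace_eq hX s.rotate.reflect]
      exact ⟨left_mem_halfspace s.dc.symm, right_not_mem_halfspace⟩
  have hsymm : ∀ e e', (X.restrict Y).Opposite e e' → (X.restrict Y).Opposite e' e := by
    rintro _ _ ⟨p, q, c, d, s, rfl, rfl⟩
    exact ⟨d, c, q, p, s.rotate.rotate.rotate.reflect, rfl, rfl⟩
  have key' : ∀ e e', Relation.EqvGen (X.restrict Y).Opposite e e' →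
      (e ∈ X.crossing Y (X.halfspace a b) ↔ e' ∈ X.crossing Y (X.halfspace a b)) := by
    intro e e' h
    induction h with
    | rel _ _ h => exact ⟨key _ _ h, key _ _ (hsymm _ _ h)⟩
    | refl => rfl
    | symm _ _ _ ih => exact ih.symm
    | trans _ _ _ _ _ ih ih' => exact ih.trans ih'
  ext e
  constructor
  · intro h
    exact (key' _ _ h).1 (mem_crossing.2 ⟨ha, hb, hab,
      .inl ⟨left_mem_halfspace hab, right_not_mem_halfspace⟩⟩)
  · rintro ⟨x, hx, y, hy, hxy, h1, h2, rfl⟩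
    exact (eqvGen_opposite_of_crossing hX hY ha hb hx hy hab hxy h1 h2).1

theorem mem_hyperplanes_restrict (hY : X.IsConvexSet Y) {L : Set (Sym2 V)} :
    L ∈ (X.restrict Y).hyperplanes ↔
      ∃ a ∈ Y, ∃ b ∈ Y, X.graph.Adj a b ∧ L = X.crossing Y (X.halfspace a b) := by
  constructor
  · rintro ⟨e, he, rfl⟩
    induction e with
    | _ a b =>
      obtain ⟨hab, ha, hb⟩ := restrict_adj.1 ((SimpleGraph.mem_edgeSet _).1 he)
      exact ⟨a, ha, b, hb, hab, hyperplane_eq_crossing hX hY ha hb hab⟩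
  · rintro ⟨a, ha, b, hb, hab, rfl⟩
    exact ⟨s(a, b), (SimpleGraph.mem_edgeSet _).2 (restrict_adj.2 ⟨hab, ha, hb⟩),
      (hyperplane_eq_crossing hX hY ha hb hab).symm⟩

theorem halfspace_eq_or_of_crossing_eq (ha : a ∈ Y) (hb : b ∈ Y) (hab : X.graph.Adj a b)
    (hcd : X.graph.Adj c d)
    (h : X.crossing Y (X.halfspace c d) = X.crossing Y (X.halfspace a b)) :
    X.halfspace c d = X.halfspace a b ∨ X.halfspace c d = X.halfspace b a := by
  have hm : s(a, b) ∈ X.crossing Y (X.halfspace c d) := by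
    rw [h]
    exact mem_crossing.2 ⟨ha, hb, hab, .inl ⟨left_mem_halfspace hab, right_not_mem_halfspace⟩⟩
  obtain ⟨-, -, -, ⟨h1, h2⟩ | ⟨h1, h2⟩⟩ := mem_crossing.1 hm
  · exact .inl (halfspace_eq_of_crossing hX hcd hab h1 h2)
  · exact .inr (halfspace_eq_of_crossing hX hcd hab.symm h1 h2)

theorem halfspace_mem_complementaryComponents (hab : X.graph.Adj a b) :
    X.halfspace a b ∈
      X.complementaryComponents (X.crossing X.vertices (X.halfspace a b)) := by
  refine ⟨a, mem_vertices_left hab, ?_⟩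
  ext w
  constructor
  · intro hw
    show (X.graph.deleteEdges _).Reachable a w
    induction hk : X.graph.dist a w generalizing w with
    | zero =>
      rw [(hX.dist_eq_zero (mem_vertices_left hab) hw.1).1 hk]
    | succ k ih =>
      have hne : w ≠ a := by rintro rfl; simp at hk
      obtain ⟨u, hwu, hd⟩ := hX.exists_adj_dist hw.1 (mem_vertices_left hab) hne
      have hu : u ∈ X.halfspace a b := (isConvexSet_halfspace hX hab).between a
        (left_mem_halfspace hab) w hw u (mem_vertices_right hwu) (by
          rw [SimpleGraph.dist_eq_one_iff_adj.2 hwu.symm]; omega)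
      refine (ih u hu (by omega)).trans (SimpleGraph.Adj.reachable ?_)
      rw [SimpleGraph.deleteEdges_adj]
      refine ⟨hwu.symm, fun h => ?_⟩
      have := (mem_crossing.1 h).2.2.2
      tauto
  · rintro ⟨p⟩
    have ha := left_mem_halfspace hab
    clear hab
    revert ha
    generalize hh : X.halfspace a b = h at p ⊢
    clear hh
    intro ha
    induction p with
    | nil => exact ha
    | cons e p ih =>
      refine ih ?_
      rw [SimpleGraph.deleteEdges_adj] at e
      by_contra hn
      exact e.2 (mem_crossing.2 ⟨mem_vertices_left e.1, mem_vertices_right e.1, e.1,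
        .inl ⟨ha, hn⟩⟩)

end Hyperplane

/-! ### Convex subcomplexes and convex sets of vertices -/

theorem ext_cubes {Y Z : CubeComplex V} (h : Y.cubes = Z.cubes) : Y = Z := by
  cases Y; cases Z; cases h; rfl

theorem restrict_vertices_self : X.restrict X.vertices = X :=
  ext_cubes (Set.ext fun _ => ⟨fun h => h.1, fun h => ⟨h, subset_vertices h⟩⟩)

theorem IsConvexSubcomplex.eq_restrict {Z : CubeComplex V} (hZ : X.IsConvexSubcomplex Z) :
    Z = X.restrict Z.vertices :=
  ext_cubes (Set.ext fun C => ⟨fun h => ⟨hZ.subset h, subset_vertices h⟩,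
    fun h => hZ.full C h.1 h.2⟩)

theorem IsConvexSubcomplex.isConvexSet (hX : X.IsCAT0) {Z : CubeComplex V}
    (hZ : X.IsConvexSubcomplex Z) : X.IsConvexSet Z.vertices where
  subset _ hv := hZ.subset hv
  between u hu v hv w hw h := by
    obtain ⟨p, hp⟩ := (hX.reachable (hZ.subset hu) hw).exists_walk_length_eq_dist
    obtain ⟨q, hq⟩ := (hX.reachable hw (hZ.subset hv)).exists_walk_length_eq_dist
    refine hZ.geodesic u hu v hv (p.append q) ?_ w (by simp)
    rw [Walk.length_append, hp, hq, h]

theorem IsConvexSet.isConvexSubcomplex (hX : X.IsCAT0) {Y : Set V} (hY : X.IsConvexSet Y)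
    (hne : Y.Nonempty) : X.IsConvexSubcomplex (X.restrict Y) where
  nonempty := by rwa [restrict_vertices hY.subset]
  subset _ h := h.1
  full C hC h := ⟨hC, by rwa [restrict_vertices hY.subset] at h⟩
  geodesic u hu v hv p hp w hw := by
    rw [restrict_vertices hY.subset] at *
    classical
    have h1 := congrArg Walk.length (p.take_spec hw)
    rw [Walk.length_append] at h1
    have h2 := SimpleGraph.dist_le (p.takeUntil w hw)
    have h3 := SimpleGraph.dist_le (p.dropUntil w hw)
    have hwv : w ∈ X.vertices := by
      have hr : X.graph.Reachable u w := ⟨p.takeUntil w hw⟩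
      by_cases huw : u = w
      · exact huw ▸ hY.subset hu
      · obtain ⟨q⟩ := hr.symm
        cases q with
        | nil => exact absurd rfl huw
        | cons e _ => exact mem_vertices_left e
    have h4 := hX.dist_triangle (hY.subset hu) hwv (hY.subset hv)
    exact hY.between u hu v hv w hwv (by omega)

end CubeComplex

namespace CubeComplex

variable {V : Type*} {X : CubeComplex V} {G : Type*} [Group G] [MulAction G V]

open SimpleGraph (Walk)

/-! ### Group actions -/

section Action

theorem IsInvariant.smul_mem_cubes (hinv : X.IsInvariant G) (g : G) {C : Set V} :
    g • C ∈ X.cubes ↔ C ∈ X.cubes :=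
  ⟨fun h => by simpa using hinv g⁻¹ _ h, hinv g C⟩

theorem IsInvariant.smul_mem_vertices (hinv : X.IsInvariant G) (g : G) {v : V} :
    g • v ∈ X.vertices ↔ v ∈ X.vertices := by
  have := hinv.smul_mem_cubes g (C := {v})
  rwa [Set.smul_set_singleton] at this

theorem IsInvariant.smul_vertices (hinv : X.IsInvariant G) (g : G) :
    g • X.vertices = X.vertices := by
  ext v
  rw [Set.mem_smul_set_iff_inv_smul_mem]
  exact hinv.smul_mem_vertices g⁻¹

theorem IsInvariant.adj_smul (hinv : X.IsInvariant G) (g : G) {a b : V} :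
    X.graph.Adj (g • a) (g • b) ↔ X.graph.Adj a b := by
  have := hinv.smul_mem_cubes g (C := {a, b})
  rw [Set.smul_set_insert, Set.smul_set_singleton] at this
  exact and_congr (MulAction.injective g).ne_iff this

theorem IsInvariant.dist_smul (hX : X.IsCAT0) (hinv : X.IsInvariant G) (g : G) {u v : V}
    (hu : u ∈ X.vertices) (hv : v ∈ X.vertices) :
    X.graph.dist (g • u) (g • v) = X.graph.dist u v := by
  have key : ∀ (g : G) {u v : V}, u ∈ X.vertices → v ∈ X.vertices →
      X.graph.dist (g • u) (g • v) ≤ X.graph.dist u v := by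
    intro g u v hu hv
    obtain ⟨p, hp⟩ := (hX.reachable hu hv).exists_walk_length_eq_dist
    let f : X.graph →g X.graph := ⟨fun v => g • v, fun h => (hinv.adj_smul g).2 h⟩
    rw [← hp, ← Walk.length_map f]
    exact SimpleGraph.dist_le (p.map f)
  refine (key g hu hv).antisymm ?_
  simpa using key g⁻¹ ((hinv.smul_mem_vertices g).2 hu) ((hinv.smul_mem_vertices g).2 hv)

theorem IsInvariant.smul_halfspace (hX : X.IsCAT0) (hinv : X.IsInvariant G) (g : G) {a b : V}
    (ha : a ∈ X.vertices) (hb : b ∈ X.vertices) :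
    g • X.halfspace a b = X.halfspace (g • a) (g • b) := by
  ext v
  rw [Set.mem_smul_set_iff_inv_smul_mem]
  have key : ∀ c ∈ X.vertices, v ∈ X.vertices →
      X.graph.dist (g⁻¹ • v) c = X.graph.dist v (g • c) := fun c hc hv => by
    have := hinv.dist_smul hX g ((hinv.smul_mem_vertices g⁻¹).2 hv) hc
    rwa [smul_inv_smul, eq_comm] at this
  simp only [halfspace, Set.mem_ofPred_eq, hinv.smul_mem_vertices]
  exact and_congr_right fun hv => by rw [key a ha hv, key b hb hv]

theorem IsInvariant.translate_crossing (hinv : X.IsInvariant G) (g : G) (Y h : Set V) :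
    translate g (X.crossing Y h) = X.crossing (g • Y) (g • h) := by
  ext e
  constructor
  · rintro ⟨_, ⟨x, hx, y, hy, hxy, h1, h2, rfl⟩, rfl⟩
    exact ⟨g • x, Set.smul_mem_smul_set hx, g • y, Set.smul_mem_smul_set hy,
      (hinv.adj_smul g).2 hxy, Set.smul_mem_smul_set h1,
      fun h => h2 (Set.smul_mem_smul_set_iff.1 h), rfl⟩
  · rintro ⟨_, ⟨x, hx, rfl⟩, _, ⟨y, hy, rfl⟩, hxy, h1, h2, rfl⟩
    exact ⟨s(x, y), ⟨x, hx, y, hy, (hinv.adj_smul g).1 hxy, Set.smul_mem_smul_set_iff.1 h1,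
      fun h => h2 (Set.smul_mem_smul_set h), rfl⟩, rfl⟩

variable {Y : Set V} {a b : V}

/-- Without inversions, the stabilizer of a hyperplane of an invariant convex subcomplex is the
stabilizer of each of its halfspaces. -/
theorem translate_crossing_eq_iff (hX : X.IsCAT0) (hinv : X.IsInvariant G)
    (hnoinv : X.NoInversions G) (hYG : ∀ g : G, g • Y = Y) (ha : a ∈ Y)
    (hb : b ∈ Y) (hab : X.graph.Adj a b) (g : G) :
    translate g (X.crossing Y (X.halfspace a b)) = X.crossing Y (X.halfspace a b) ↔
      g • X.halfspace a b = X.halfspace a b := by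
  rw [hinv.translate_crossing, hYG]
  refine ⟨fun h => ?_, fun h => by rw [h]⟩
  have hL : X.crossing X.vertices (X.halfspace a b) ∈ X.hyperplanes := by
    have := (mem_hyperplanes_restrict hX isConvexSet_vertices).2
      ⟨a, mem_vertices_left hab, b, mem_vertices_right hab, hab, rfl⟩
    rwa [restrict_vertices_self] at this
  -- Absence of inversions concerns hyperplanes of `X`, so an element stabilizing the hyperplane of
  -- `Y` must first be shown to stabilize the hyperplane of `X` containing it.
  refine hnoinv _ hL g ?_ _ (halfspace_mem_complementaryComponents hX hab)
  show translate g _ = _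
  rw [hinv.translate_crossing, hinv.smul_vertices]
  rw [hinv.smul_halfspace hX g (mem_vertices_left hab) (mem_vertices_right hab)] at h ⊢
  rcases halfspace_eq_or_of_crossing_eq hX ha hb hab ((hinv.adj_smul g).2 hab) h with e | e
  · rw [e]
  · rw [e, crossing_halfspace_symm hX subset_rfl hab]

theorem smul_halfspace_ne_symm (hX : X.IsCAT0) (hinv : X.IsInvariant G)
    (hnoinv : X.NoInversions G) (hab : X.graph.Adj a b) (g : G) :
    g • X.halfspace a b ≠ X.halfspace b a := by
  intro h
  have ha := mem_vertices_left hab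
  have hb := mem_vertices_right hab
  have h1 := (translate_crossing_eq_iff hX hinv hnoinv hinv.smul_vertices ha hb hab g).1 (by
    rw [hinv.translate_crossing, hinv.smul_vertices, h, crossing_halfspace_symm hX subset_rfl hab])
  have h2 := left_mem_halfspace hab
  rw [← h1, h] at h2
  exact right_not_mem_halfspace h2

theorem IsInvariant.isInvariant_restrict (hinv : X.IsInvariant G) (hYG : ∀ g : G, g • Y = Y) :
    (X.restrict Y).IsInvariant G := fun g C hC =>
  ⟨hinv g C hC.1, by rw [← hYG g]; exact Set.smul_set_mono hC.2⟩

end Action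

/-! ### Orbits of hyperplanes -/

section Orbits

variable (G) in
/-- The `G`-orbits of the hyperplanes of `X` that cross `Y`. -/
def crossingOrbits (X : CubeComplex V) (Y : Set V) : Set (Set (Set (Sym2 V))) :=
  {O | ∃ a ∈ Y, ∃ b ∈ Y, X.graph.Adj a b ∧
    O = Set.range fun g : G => translate g (X.crossing X.vertices (X.halfspace a b))}

theorem crossingOrbits_mono {Y Z : Set V} (h : Y ⊆ Z) :
    X.crossingOrbits G Y ⊆ X.crossingOrbits G Z := by
  rintro _ ⟨a, ha, b, hb, hab, rfl⟩
  exact ⟨a, h ha, b, h hb, hab, rfl⟩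

theorem range_translate_eq_iff {L M : Set (Sym2 V)} :
    ((Set.range fun g : G => translate g L) = Set.range fun g : G => translate g M) ↔
      ∃ g : G, translate g L = M := by
  constructor
  · intro h
    have : M ∈ Set.range fun g : G => translate g L := by
      rw [h]
      exact ⟨1, translate_one M⟩
    exact this
  · rintro ⟨g, rfl⟩
    ext K
    constructor
    · rintro ⟨k, rfl⟩
      exact ⟨k * g⁻¹, by simp only [← translate_mul, inv_mul_cancel_right]⟩
    · rintro ⟨k, rfl⟩
      exact ⟨k * g, translate_mul k g L⟩

/-- Hyperplanes of different subcomplexes are different edge sets. Counting orbits of hyperplanes of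
`X` instead makes the counts monotone in `Y`; both families are indexed by the edges of `Y` and have
the same fibres. -/
theorem encard_hyperplaneOrbits_restrict (hX : X.IsCAT0) (hinv : X.IsInvariant G) {Y : Set V}
    (hY : X.IsConvexSet Y) (hYG : ∀ g : G, g • Y = Y) :
    ((X.restrict Y).hyperplaneOrbits G).encard = (X.crossingOrbits G Y).encard := by
  have key : ∀ a ∈ Y, ∀ b ∈ Y, X.graph.Adj a b → ∀ c ∈ Y, ∀ d ∈ Y, X.graph.Adj c d →
      (((Set.range fun g : G => translate g (X.crossing Y (X.halfspace a b))) =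
        Set.range fun g : G => translate g (X.crossing Y (X.halfspace c d))) ↔
      ((Set.range fun g : G => translate g (X.crossing X.vertices (X.halfspace a b))) =
        Set.range fun g : G => translate g (X.crossing X.vertices (X.halfspace c d)))) := by
    intro a ha b hb hab c hc d hd hcd
    rw [range_translate_eq_iff, range_translate_eq_iff]
    refine exists_congr fun g => ?_
    rw [hinv.translate_crossing, hinv.translate_crossing, hYG, hinv.smul_vertices,
      hinv.smul_halfspace hX _ (hY.subset ha) (hY.subset hb)]
    have hg := (hinv.adj_smul g).2 hab
    constructor
    · intro h
      rcases halfspace_eq_or_of_crossing_eq hX hc hd hcd hg h with e | e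
      · rw [e]
      · rw [e, crossing_halfspace_symm hX subset_rfl hcd]
    · intro h
      rcases halfspace_eq_or_of_crossing_eq hX (hY.subset hc) (hY.subset hd) hcd hg h with e | e
      · rw [e]
      · rw [e, crossing_halfspace_symm hX hY.subset hcd]
  let T := {p : V × V // p.1 ∈ Y ∧ p.2 ∈ Y ∧ X.graph.Adj p.1 p.2}
  let f : T → Set (Set (Sym2 V)) := fun p =>
    Set.range fun g : G => translate g (X.crossing Y (X.halfspace p.1.1 p.1.2))
  let f' : T → Set (Set (Sym2 V)) := fun p =>
    Set.range fun g : G => translate g (X.crossing X.vertices (X.halfspace p.1.1 p.1.2))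
  have h1 : (X.restrict Y).hyperplaneOrbits G = Set.range f := by
    ext O
    constructor
    · rintro ⟨L, hL, rfl⟩
      obtain ⟨a, ha, b, hb, hab, rfl⟩ := (mem_hyperplanes_restrict hX hY).1 hL
      exact ⟨⟨(a, b), ha, hb, hab⟩, rfl⟩
    · rintro ⟨⟨⟨a, b⟩, ha, hb, hab⟩, rfl⟩
      exact ⟨_, (mem_hyperplanes_restrict hX hY).2 ⟨a, ha, b, hb, hab, rfl⟩, rfl⟩
  have h2 : X.crossingOrbits G Y = Set.range f' := by
    ext O
    constructor
    · rintro ⟨a, ha, b, hb, hab, rfl⟩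
      exact ⟨⟨(a, b), ha, hb, hab⟩, rfl⟩
    · rintro ⟨⟨⟨a, b⟩, ha, hb, hab⟩, rfl⟩
      exact ⟨a, ha, b, hb, hab, rfl⟩
  have h3 : ∀ s t : T, f s = f t ↔ f' s = f' t := fun s t =>
    key _ s.2.1 _ s.2.2.1 s.2.2.2 _ t.2.1 _ t.2.2.1 t.2.2.2
  rw [h1, h2]
  refine Set.encard_congr ⟨fun x => ⟨f' x.2.choose, _, rfl⟩, fun x => ⟨f x.2.choose, _, rfl⟩,
    fun x => ?_, fun x => ?_⟩
  · refine Subtype.ext (((h3 _ _).2 ?_).trans x.2.choose_spec)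
    exact Exists.choose_spec (⟨_, rfl⟩ : f' x.2.choose ∈ Set.range f')
  · refine Subtype.ext (((h3 _ _).1 ?_).trans x.2.choose_spec)
    exact Exists.choose_spec (⟨_, rfl⟩ : f x.2.choose ∈ Set.range f)

end Orbits

end CubeComplex

namespace CubeComplex

variable {V : Type*} {X : CubeComplex V} {G : Type*} [Group G] [MulAction G V]

/-! ### Minimal invariant convex subcomplexes -/

section Existence

theorem smul_set_eq_of_subset {Y : Set V} (h : ∀ g : G, g • Y ⊆ Y) (g : G) : g • Y = Y :=
  (h g).antisymm (Set.subset_smul_set_iff.2 (h g⁻¹))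

/-- If `G` is finitely generated, then the convex hull of an orbit of vertices is crossed by only
finitely many orbits of hyperplanes. -/
theorem exists_finite_crossingOrbits (hG : Group.FG G) (hX : X.IsCAT0) (hinv : X.IsInvariant G) :
    ∃ Y : Set V, X.IsConvexSet Y ∧ Y.Nonempty ∧ (∀ g : G, g • Y = Y) ∧
      (X.crossingOrbits G Y).Finite := by
  obtain ⟨v, hv⟩ := hX.simplyConnected.nonempty
  obtain ⟨S, hS, hSf⟩ := Group.fg_iff.1 hG
  have hvg : ∀ g : G, g • v ∈ X.vertices := fun g => (hinv.smul_mem_vertices g).2 hv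
  -- The convex hull of the orbit of `v`, as an intersection of halfspaces.
  let Y : Set V := {w | w ∈ X.vertices ∧ ∀ a b, X.graph.Adj a b →
    (∀ g : G, g • v ∈ X.halfspace a b) → w ∈ X.halfspace a b}
  have hYc : X.IsConvexSet Y := by
    refine ⟨fun w hw => hw.1, fun u hu w hw z hz h => ⟨hz, fun a b hab hg => ?_⟩⟩
    exact (isConvexSet_halfspace hX hab).between u (hu.2 a b hab hg) w (hw.2 a b hab hg) z hz h
  refine ⟨Y, hYc, ⟨v, hv, fun a b _ hg => by simpa using hg 1⟩, smul_set_eq_of_subset ?_, ?_⟩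
  · rintro g _ ⟨w, hw, rfl⟩
    refine ⟨(hinv.smul_mem_vertices g).2 hw.1, fun a b hab hg => ?_⟩
    have h1 := hw.2 (g⁻¹ • a) (g⁻¹ • b) ((hinv.adj_smul g⁻¹).2 hab) (fun k => by
      rw [← hinv.smul_halfspace hX g⁻¹ (mem_vertices_left hab) (mem_vertices_right hab),
        Set.mem_smul_set_iff_inv_smul_mem, inv_inv, ← mul_smul]
      exact hg _)
    rw [← hinv.smul_halfspace hX g⁻¹ (mem_vertices_left hab) (mem_vertices_right hab),
      Set.mem_smul_set_iff_inv_smul_mem, inv_inv] at h1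
    exact h1
  · let F : Set (Set V) := ⋃ s ∈ S,
      ({h | (∃ a b, X.graph.Adj a b ∧ h = X.halfspace a b) ∧ v ∈ h ∧ s • v ∉ h} ∪
        {h | (∃ a b, X.graph.Adj a b ∧ h = X.halfspace a b) ∧ s • v ∈ h ∧ v ∉ h})
    have hF : F.Finite := hSf.biUnion fun s _ =>
      (finite_separating hX hv (hvg s)).union (finite_separating hX (hvg s) hv)
    refine (hF.image fun h => Set.range fun g : G =>
      translate g (X.crossing X.vertices h)).subset ?_
    rintro _ ⟨a, ha, b, hb, hab, rfl⟩
    obtain ⟨g₁, hg₁⟩ : ∃ g : G, g • v ∉ X.halfspace a b := by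
      by_contra! h
      exact right_not_mem_halfspace (hb.2 a b hab h)
    obtain ⟨g₂, hg₂⟩ : ∃ g : G, g • v ∈ X.halfspace a b := by
      by_contra! h
      exact right_not_mem_halfspace
        (ha.2 b a hab.symm fun g => (mem_halfspace_symm hX hab (hvg g)).2 (h g))
    -- The halfspace separates two orbit points. If right multiplication by generators never changed
    -- sides, the whole orbit would be on one side.
    obtain ⟨s, hs, g, hg⟩ : ∃ s ∈ S, ∃ g : G,
        ¬ (g • v ∈ X.halfspace a b ↔ (g * s) • v ∈ X.halfspace a b) := by
      by_contra! h
      have key : ∀ k : G, ∀ g : G, g • v ∈ X.halfspace a b ↔ (g * k) • v ∈ X.halfspace a b := by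
        intro k
        have hk : k ∈ Subgroup.closure S := hS ▸ Subgroup.mem_top k
        induction hk using Subgroup.closure_induction with
        | mem s hs => exact fun g => h s hs g
        | one => simp
        | mul x y _ _ hx hy => exact fun g => by rw [hx g, hy (g * x), mul_assoc]
        | inv x _ hx => exact fun g => by rw [hx (g * x⁻¹), inv_mul_cancel_right]
      have := key (g₁⁻¹ * g₂) g₁
      rw [mul_inv_cancel_left] at this
      exact hg₁ (this.2 hg₂)
    refine ⟨g⁻¹ • X.halfspace a b, ?_, ?_⟩
    · refine Set.mem_biUnion hs ?_
      have h1 : ∃ c d, X.graph.Adj c d ∧ g⁻¹ • X.halfspace a b = X.halfspace c d :=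
        ⟨_, _, (hinv.adj_smul g⁻¹).2 hab,
          hinv.smul_halfspace hX g⁻¹ (mem_vertices_left hab) (mem_vertices_right hab)⟩
      rw [mul_smul] at hg
      simp only [Set.mem_union, Set.mem_ofPred_eq, h1, true_and,
        Set.mem_smul_set_iff_inv_smul_mem, inv_inv]
      tauto
    · refine range_translate_eq_iff.2 ⟨g, ?_⟩
      rw [hinv.translate_crossing, hinv.smul_vertices, smul_inv_smul]

/-- A nonempty invariant convex set of vertices that contains no smaller one. -/
structure IsMinimalSet (G : Type*) [Group G] [MulAction G V] (X : CubeComplex V) (Y : Set V) :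
    Prop where
  convex : X.IsConvexSet Y
  nonempty : Y.Nonempty
  invariant : ∀ g : G, g • Y = Y
  minimal : ∀ Z ⊆ Y, X.IsConvexSet Z → Z.Nonempty → (∀ g : G, g • Z = Z) → Z = Y

theorem exists_isMinimalInvariantConvex (hG : Group.FG G) (hX : X.IsCAT0)
    (hinv : X.IsInvariant G) :
    ∃ Y : Set V, X.IsMinimalSet G Y ∧ X.IsMinimalInvariantConvex G (X.restrict Y) ∧
      ((X.restrict Y).hyperplaneOrbits G).Finite := by
  let P : Set (Set V) := {Y | X.IsConvexSet Y ∧ Y.Nonempty ∧ ∀ g : G, g • Y = Y}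
  obtain ⟨Y₀, h₁, h₂, h₃, h₄⟩ := exists_finite_crossingOrbits hG hX hinv
  obtain ⟨Y, ⟨hYc, hYn, hYG⟩, hmin⟩ : ∃ Y ∈ P, ∀ Z ∈ P,
      (X.crossingOrbits G Y).encard ≤ (X.crossingOrbits G Z).encard := by
    obtain ⟨Y, hY, h⟩ := WellFounded.has_min
      (InvImage.wf (fun Y : Set V => (X.crossingOrbits G Y).encard) wellFounded_lt) P
      ⟨Y₀, h₁, h₂, h₃⟩
    exact ⟨Y, hY, fun Z hZ => not_lt.1 (h Z hZ)⟩
  have hfin : (X.crossingOrbits G Y).Finite := by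
    rw [← Set.encard_lt_top_iff] at h₄ ⊢
    exact (hmin Y₀ ⟨h₁, h₂, h₃⟩).trans_lt h₄
  have hmini : X.IsMinimalSet G Y := by
    refine ⟨hYc, hYn, hYG, fun Z hZY hZc hZn hZG => hZY.antisymm fun w hw => ?_⟩
    by_contra hwZ
    -- The hyperplane dual to `p q` crosses `Y` and has `Z` on one side. Equality of the orbit
    -- counts would make a translate of it cross `Z`, hence, by invariance of `Z`, the hyperplane
    -- itself.
    obtain ⟨p, hp, q, hq, hpq, hd, hsub⟩ := hZc.exists_separating hX hZn (hYc.subset hw) hwZ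
    have hqY : q ∈ Y := hYc.between p (hZY hp) w hw q hq hd
    have heq : X.crossingOrbits G Z = X.crossingOrbits G Y :=
      (hfin.subset (crossingOrbits_mono hZY)).eq_of_subset_of_encard_le
        (crossingOrbits_mono hZY) (hmin Z ⟨hZc, hZn, hZG⟩)
    have hm : (Set.range fun g : G => translate g (X.crossing X.vertices (X.halfspace p q))) ∈
        X.crossingOrbits G Z := by
      rw [heq]
      exact ⟨p, hZY hp, q, hqY, hpq, rfl⟩
    obtain ⟨a, ha, b, hb, hab, he⟩ := hm
    obtain ⟨g, hg⟩ := range_translate_eq_iff.1 he.symm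
    rw [hinv.translate_crossing, hinv.smul_vertices,
      hinv.smul_halfspace hX g (hZc.subset ha) (hZc.subset hb)] at hg
    have hs : s(g • a, g • b) ∈ X.crossing X.vertices (X.halfspace p q) := by
      rw [← hg]
      have hgab := (hinv.adj_smul g).2 hab
      exact mem_crossing.2 ⟨mem_vertices_left hgab, mem_vertices_right hgab, hgab,
        .inl ⟨left_mem_halfspace hgab, right_not_mem_halfspace⟩⟩
    have h1 : g • a ∈ X.halfspace p q := hsub (hZG g ▸ Set.smul_mem_smul_set ha)
    have h2 : g • b ∈ X.halfspace p q := hsub (hZG g ▸ Set.smul_mem_smul_set hb)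
    have := (mem_crossing.1 hs).2.2.2
    tauto
  have horb := encard_hyperplaneOrbits_restrict hX hinv hYc hYG
  refine ⟨Y, hmini, ⟨hYc.isConvexSubcomplex hX hYn, hinv.isInvariant_restrict hYG, ?_, ?_⟩, ?_⟩
  · intro Z hZ hZG hZY
    have hsub : Z.vertices ⊆ Y := fun v hv => by simpa using (hZY hv).2
    have := hmini.minimal Z.vertices hsub (hZ.isConvexSet hX) hZ.nonempty
      (IsInvariant.smul_vertices hZG)
    rw [← this, ← hZ.eq_restrict]
  · intro Z hZ hZG
    have hZc := hZ.isConvexSet hX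
    have hZG' : ∀ g : G, g • Z.vertices = Z.vertices := IsInvariant.smul_vertices hZG
    rw [hZ.eq_restrict, horb, encard_hyperplaneOrbits_restrict hX hinv hZc hZG']
    exact hmin _ ⟨hZc, hZ.nonempty, hZG'⟩
  · rw [← Set.encard_lt_top_iff, horb]
    exact hfin.encard_lt_top

end Existence

/-! ### Orbits of halfspaces -/

section Orbit

variable {Y : Set V}

/-- A point-finite family of halfspaces whose complements pairwise meet in `Y` does not cover
`Y`. -/
theorem exists_forall_not_mem (hX : X.IsCAT0) (hY : X.IsConvexSet Y) (hne : Y.Nonempty)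
    {H : Set (Set V)} (hH : ∀ k ∈ H, ∃ p q, X.graph.Adj p q ∧ k = X.halfspace p q)
    (hfin : ∀ w ∈ Y, {k | k ∈ H ∧ w ∈ k}.Finite)
    (hpair : ∀ k ∈ H, ∀ k' ∈ H, ∃ w ∈ Y, w ∉ k ∧ w ∉ k') : ∃ w ∈ Y, ∀ k ∈ H, w ∉ k := by
  obtain ⟨w, hw, hmin⟩ := WellFounded.has_min
    (measure fun w => {k | k ∈ H ∧ w ∈ k}.ncard).wf Y hne
  refine ⟨w, hw, fun k hk hwk => ?_⟩
  obtain ⟨p, q, hpq, rfl⟩ := hH k hk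
  have hC : X.IsConvexSet (Y ∩ X.halfspace q p) := hY.inter (isConvexSet_halfspace hX hpq.symm)
  have hCne : (Y ∩ X.halfspace q p).Nonempty := by
    obtain ⟨z, hz, hzk, -⟩ := hpair _ hk _ hk
    exact ⟨z, hz, (mem_halfspace_symm hX hpq (hY.subset hz)).2 hzk⟩
  -- The gate `z` of `w` outside `k` leaves `k` and enters no other member `k'`: it lies on a
  -- geodesic from `w` to a vertex outside both `k` and `k'`.
  obtain ⟨z, hz, hgate⟩ := hC.exists_gate hX hCne (hY.subset hw)
  refine hmin z hz.1 (Set.ncard_lt_ncard ⟨?_, fun hsub => ?_⟩ (hfin w hw))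
  · rintro k' ⟨hk', hzk'⟩
    refine ⟨hk', ?_⟩
    by_contra hwk'
    obtain ⟨c, d, hcd, rfl⟩ := hH k' hk'
    obtain ⟨x, hx, hxk, hxk'⟩ := hpair _ hk _ hk'
    have hxv := hY.subset hx
    have h1 := hgate x ⟨hx, (mem_halfspace_symm hX hpq hxv).2 hxk⟩
    have h2 := (isConvexSet_halfspace hX hcd.symm).between w
      ((mem_halfspace_symm hX hcd (hY.subset hw)).2 hwk') x
      ((mem_halfspace_symm hX hcd hxv).2 hxk') z (hY.subset hz.1) h1.symm
    exact not_mem_halfspace_symm hzk' h2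
  · exact not_mem_halfspace_symm (hsub ⟨hk, hwk⟩).2 hz.2

variable {a b : V}

/-- In a minimal invariant convex set, the translates of a halfspace that form a point-finite family
do not all have pairwise intersecting complements. -/
theorem IsMinimalSet.exists_subset_union (hX : X.IsCAT0) (hinv : X.IsInvariant G)
    (hY : X.IsMinimalSet G Y) (ha : a ∈ Y) (hab : X.graph.Adj a b)
    (hfin : ∀ w ∈ Y, {k | k ∈ MulAction.orbit G (X.halfspace a b) ∧ w ∈ k}.Finite) :
    ∃ g : G, Y ⊆ X.halfspace a b ∪ g • X.halfspace a b := by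
  have hav := mem_vertices_left hab
  have hbv := mem_vertices_right hab
  by_contra! hcon
  obtain ⟨w, hw, hwk⟩ := exists_forall_not_mem hX hY.convex hY.nonempty
    (H := MulAction.orbit G (X.halfspace a b)) (by
      rintro _ ⟨g, rfl⟩
      exact ⟨_, _, (hinv.adj_smul g).2 hab, hinv.smul_halfspace hX g hav hbv⟩) hfin (by
      rintro _ ⟨g, rfl⟩ _ ⟨g', rfl⟩
      obtain ⟨w, hw, hn⟩ := Set.not_subset.1 (hcon (g⁻¹ * g'))
      rw [Set.mem_union, not_or, mul_smul, Set.mem_smul_set_iff_inv_smul_mem, inv_inv] at hn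
      refine ⟨g • w, hY.invariant g ▸ Set.smul_mem_smul_set hw, ?_, hn.2⟩
      exact fun h => hn.1 (Set.smul_mem_smul_set_iff.1 h))
  -- The vertices of `Y` outside all translates form an invariant convex set, nonempty by the choice
  -- of `w`. Minimality makes it all of `Y`, although `a` lies in the halfspace.
  let Z : Set V := {w | w ∈ Y ∧ ∀ g : G, w ∈ X.halfspace (g • b) (g • a)}
  have hZ : Z = Y := by
    refine hY.minimal Z (fun w hw => hw.1) ⟨fun w hw => hY.convex.subset hw.1, ?_⟩ ⟨w, hw, ?_⟩
      (smul_set_eq_of_subset ?_)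
    · intro u hu z hz x hx h
      exact ⟨hY.convex.between u hu.1 z hz.1 x hx h, fun g =>
        (isConvexSet_halfspace hX ((hinv.adj_smul g).2 hab.symm)).between u (hu.2 g) z (hz.2 g)
          x hx h⟩
    · intro g
      rw [mem_halfspace_symm hX ((hinv.adj_smul g).2 hab) (hY.convex.subset hw),
        ← hinv.smul_halfspace hX g hav hbv]
      exact hwk _ ⟨g, rfl⟩
    · rintro g _ ⟨u, hu, rfl⟩
      refine ⟨hY.invariant g ▸ Set.smul_mem_smul_set hu.1, fun k => ?_⟩
      have := hu.2 (g⁻¹ * k)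
      rwa [mul_smul, mul_smul, ← hinv.smul_halfspace hX g⁻¹ ((hinv.smul_mem_vertices k).2 hbv)
        ((hinv.smul_mem_vertices k).2 hav), Set.mem_smul_set_iff_inv_smul_mem, inv_inv] at this
  have h1 : a ∈ Z := hZ ▸ ha
  have := h1.2 1
  rw [one_smul, one_smul] at this
  exact right_not_mem_halfspace this

/-- Each translate missing `b` has a partner, covering `Y` together with it, that contains `b`. Only
finitely many partners exist, so an infinite orbit would have one partner shared by infinitely many
translates. Moving this partner to `h`, which misses `b`, puts `b` in infinitely many translates. -/
theorem finite_orbit_of_subset_union {h : Set V} (hYG : ∀ g : G, g • Y = Y) (hb : b ∈ Y)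
    (hbh : b ∉ h) (hfin : {k | k ∈ MulAction.orbit G h ∧ b ∈ k}.Finite) {g₁ : G}
    (hg₁ : Y ⊆ h ∪ g₁ • h) : (MulAction.orbit G h).Finite := by
  have htrans : ∀ g x : G, Y ⊆ g • h ∪ x • h → ∀ k : G, Y ⊆ (k * g) • h ∪ (k * x) • h := by
    intro g x hs k
    rw [mul_smul, mul_smul, ← Set.smul_set_union, ← hYG k]
    exact Set.smul_set_mono hs
  by_contra hinf
  have hD : (MulAction.orbit G h \ {k | k ∈ MulAction.orbit G h ∧ b ∈ k}).Infinite :=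
    Set.Infinite.sdiff hinf hfin
  let r : Set V → G := fun k => Classical.epsilon fun g => g • h = k
  have hr : ∀ k ∈ MulAction.orbit G h, r k • h = k := fun k hk => Classical.epsilon_spec hk
  obtain ⟨c, hc, hcinf⟩ : ∃ c ∈ {k | k ∈ MulAction.orbit G h ∧ b ∈ k},
      {k | k ∈ MulAction.orbit G h ∧ Y ⊆ k ∪ c}.Infinite := by
    by_contra! hcon
    refine hD ((hfin.biUnion hcon).subset ?_)
    rintro k ⟨hk, hbk⟩
    have h1 := htrans 1 g₁ (by rwa [one_smul]) (r k)
    rw [mul_one, hr k hk] at h1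
    refine Set.mem_biUnion (x := (r k * g₁) • h) ⟨⟨_, rfl⟩, ?_⟩ ⟨hk, h1⟩
    exact (h1 hb).resolve_left fun h => hbk ⟨hk, h⟩
  obtain ⟨⟨g₂, rfl⟩, -⟩ := hc
  have h2 := hcinf.image (f := fun k => g₂⁻¹ • k) (MulAction.injective _).injOn
  refine h2 (hfin.subset ?_)
  rintro _ ⟨_, ⟨⟨g, rfl⟩, hs⟩, rfl⟩
  refine ⟨⟨g₂⁻¹ * g, mul_smul _ _ _⟩, ?_⟩
  have h3 := htrans _ _ hs g₂⁻¹
  rw [inv_mul_cancel, one_smul, mul_smul] at h3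
  exact (h3 hb).resolve_right hbh

/-- In a minimal invariant convex set, the translates of a halfspace do not form a point-finite
family. -/
theorem IsMinimalSet.not_pointFinite (hX : X.IsCAT0) (hinv : X.IsInvariant G)
    (hnoinv : X.NoInversions G) (hY : X.IsMinimalSet G Y) (ha : a ∈ Y) (hb : b ∈ Y)
    (hab : X.graph.Adj a b) :
    ¬ ∀ w ∈ Y, {k | k ∈ MulAction.orbit G (X.halfspace a b) ∧ w ∈ k}.Finite := by
  intro hfin
  have hav := mem_vertices_left hab
  have hbv := mem_vertices_right hab
  obtain ⟨g₁, hg₁⟩ := hY.exists_subset_union hX hinv ha hab hfin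
  have horb := finite_orbit_of_subset_union hY.invariant hb right_not_mem_halfspace (hfin b hb) hg₁
  have horb' : (MulAction.orbit G (X.halfspace b a)).Finite := by
    refine (horb.image fun k => X.vertices \ k).subset ?_
    rintro _ ⟨g, rfl⟩
    refine ⟨g • X.halfspace a b, ⟨g, rfl⟩, ?_⟩
    simp only [halfspace_symm hX hab, Set.smul_set_sdiff, hinv.smul_vertices]
  obtain ⟨g₂, hg₂⟩ := hY.exists_subset_union hX hinv hb hab.symm
    fun w _ => horb'.subset fun k hk => hk.1
  set h := X.halfspace a b with hh
  have hmemY : ∀ (g : G) {w : V}, w ∈ Y → g • w ∈ Y := fun g w hw =>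
    hY.invariant g ▸ Set.smul_mem_smul_set hw
  have hdisj : ∀ w ∈ Y, w ∈ h → w ∉ g₂ • h := by
    intro w hw hwh hwg
    rcases hg₂ hw with h1 | h1
    · exact not_mem_halfspace_symm h1 hwh
    · rw [Set.mem_smul_set_iff_inv_smul_mem] at h1 hwg
      exact not_mem_halfspace_symm h1 hwg
  have hlt : ∀ w ∈ Y, w ∈ (g₁ * g₂) • h → w ∈ h := by
    intro w hw hwg
    by_contra hwh
    have h1 := (hg₁ hw).resolve_left hwh
    rw [Set.mem_smul_set_iff_inv_smul_mem] at h1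
    rw [mul_smul, Set.mem_smul_set_iff_inv_smul_mem] at hwg
    exact hdisj _ (hmemY _ hw) h1 hwg
  -- The inclusion is strict: equality would force `g₁ • h` to contain `b` but not `a`, hence to be
  -- the opposite halfspace, an inversion.
  obtain ⟨w, hwY, hwh, hwg⟩ : ∃ w ∈ Y, w ∈ h ∧ w ∉ (g₁ * g₂) • h := by
    by_contra! hcon
    refine smul_halfspace_ne_symm hX hinv hnoinv hab g₁ ?_
    have h1 : b ∈ g₁ • h := (hg₁ hb).resolve_left right_not_mem_halfspace
    have h2 : a ∉ g₁ • h := by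
      have := hcon a ha (left_mem_halfspace hab)
      rw [mul_smul, Set.mem_smul_set_iff_inv_smul_mem] at this
      rw [Set.mem_smul_set_iff_inv_smul_mem]
      exact fun h' => hdisj _ (hmemY _ ha) h' this
    rw [hinv.smul_halfspace hX g₁ hav hbv] at h1 h2 ⊢
    exact halfspace_eq_of_crossing hX ((hinv.adj_smul g₁).2 hab) hab.symm h1 h2
  have hpow : ∀ n : ℕ, ∀ w ∈ Y, w ∈ (g₁ * g₂) ^ n • h → w ∈ h := by
    intro n
    induction n with
    | zero => intro w _ hw; simpa using hw
    | succ n ih =>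
      intro w hw hwn
      rw [pow_succ', mul_smul, Set.mem_smul_set_iff_inv_smul_mem] at hwn
      refine hlt w hw ?_
      rw [Set.mem_smul_set_iff_inv_smul_mem]
      exact ih _ (hmemY _ hw) hwn
  obtain ⟨i, j, hij, he⟩ : ∃ i j : ℕ, i < j ∧ (g₁ * g₂) ^ i • h = (g₁ * g₂) ^ j • h := by
    obtain ⟨i, -, j, -, hne, he⟩ := Set.infinite_univ.exists_ne_map_eq_of_mapsTo
      (f := fun n : ℕ => (g₁ * g₂) ^ n • h) (t := MulAction.orbit G h)
      (fun n _ => ⟨_, rfl⟩) horb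
    rcases lt_or_gt_of_ne hne with h1 | h1
    · exact ⟨i, j, h1, he⟩
    · exact ⟨j, i, h1, he.symm⟩
  -- Here `j = i + n + 1`. After cancelling the `i`-th power, `h` is its own translate by the power
  -- `n + 1`, which in `Y` is contained in `(g₁ * g₂) • h`.
  obtain ⟨n, rfl⟩ := Nat.exists_eq_add_of_lt hij
  rw [add_assoc, pow_add, mul_smul, smul_left_cancel_iff] at he
  rw [he, pow_succ', mul_smul, Set.mem_smul_set_iff_inv_smul_mem] at hwh
  refine hwg ?_
  rw [Set.mem_smul_set_iff_inv_smul_mem]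
  exact hpow n _ (hmemY _ hwY) hwh

end Orbit

/-! ### Hyperplane stabilizers -/

section Stabilizer

variable {Y : Set V} {a b v : V}

/-- `H`-finiteness would leave finitely many translates containing `v`. A translate containing
another vertex `w` either contains `v` or separates `w` from `v`, so the orbit would be
point-finite. -/
theorem IsMinimalSet.not_isHFinite (hX : X.IsCAT0) (hinv : X.IsInvariant G)
    (hnoinv : X.NoInversions G) (hY : X.IsMinimalSet G Y) (ha : a ∈ Y) (hb : b ∈ Y)
    (hab : X.graph.Adj a b) (hv : v ∈ Y) {H : Subgroup G}
    (hH : ∀ g ∈ H, g • X.halfspace a b = X.halfspace a b) :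
    ¬ IsHFinite H {g : G | g • v ∈ X.halfspace a b} := by
  rintro ⟨F, hF, hsub⟩
  refine hY.not_pointFinite hX hinv hnoinv ha hb hab fun w hw => ?_
  refine ((hF.image fun f => f⁻¹ • X.halfspace a b).union
    (finite_separating hX (hY.convex.subset hw) (hY.convex.subset hv))).subset ?_
  rintro _ ⟨⟨g, rfl⟩, hwk⟩
  by_cases hvk : v ∈ g • X.halfspace a b
  · left
    rw [Set.mem_smul_set_iff_inv_smul_mem] at hvk
    obtain ⟨k, hk, f, hf, he⟩ := hsub hvk
    refine ⟨f, hf, ?_⟩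
    have : g = f⁻¹ * k⁻¹ := by
      rw [← mul_inv_rev, show k * f = g⁻¹ from he, inv_inv]
    simp only [this, mul_smul, hH _ (H.inv_mem hk)]
  · right
    exact ⟨⟨_, _, (hinv.adj_smul g).2 hab,
      hinv.smul_halfspace hX g (mem_vertices_left hab) (mem_vertices_right hab)⟩, hwk, hvk⟩

theorem IsMinimalSet.isCodimensionOne (hX : X.IsCAT0) (hinv : X.IsInvariant G)
    (hnoinv : X.NoInversions G) (hY : X.IsMinimalSet G Y) {L : Set (Sym2 V)}
    (hL : L ∈ (X.restrict Y).hyperplanes) : IsCodimensionOne (hyperplaneStabilizer G L) := by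
  obtain ⟨a, ha, b, hb, hab, rfl⟩ := (mem_hyperplanes_restrict hX hY.convex).1 hL
  have hav := mem_vertices_left hab
  have hbv := mem_vertices_right hab
  obtain ⟨v, hv⟩ := hY.nonempty
  have hvg : ∀ g : G, g • v ∈ X.vertices := fun g =>
    (hinv.smul_mem_vertices g).2 (hY.convex.subset hv)
  set H := hyperplaneStabilizer G (X.crossing Y (X.halfspace a b))
  have hH : ∀ g : G, g ∈ H ↔ g • X.halfspace a b = X.halfspace a b :=
    translate_crossing_eq_iff hX hinv hnoinv hY.invariant ha hb hab
  have hH' : ∀ g ∈ H, g • X.halfspace b a = X.halfspace b a := by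
    intro g hg
    rw [halfspace_symm hX hab, Set.smul_set_sdiff, hinv.smul_vertices, (hH g).1 hg]
  refine ⟨{g | g • v ∈ X.halfspace a b}, ?_, fun g => ?_,
    hY.not_isHFinite hX hinv hnoinv ha hb hab hv fun g hg => (hH g).1 hg, ?_⟩
  · ext g
    constructor
    · rintro ⟨k, hk, x, hx, rfl⟩
      show (k * x) • v ∈ X.halfspace a b
      rw [← (hH k).1 hk, mul_smul]
      exact Set.smul_mem_smul_set hx
    · exact fun hg => ⟨1, H.one_mem, g, hg, one_mul g⟩
  · have hfin := (finite_separating hX (hY.convex.subset hv) (hvg g⁻¹)).union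
      (finite_separating hX (hvg g⁻¹) (hY.convex.subset hv))
    -- The coset of `x` modulo `H` is determined by `x⁻¹ • X.halfspace a b`. For `x` in the
    -- symmetric difference this halfspace separates `v` from `g⁻¹ • v`, so finitely many
    -- representatives suffice.
    let r : Set V → G := fun k => Classical.epsilon fun x => x⁻¹ • X.halfspace a b = k
    refine ⟨_, hfin.image r, fun x hx => ?_⟩
    have hr : (r (x⁻¹ • X.halfspace a b))⁻¹ • X.halfspace a b = x⁻¹ • X.halfspace a b :=
      Classical.epsilon_spec (p := fun y => y⁻¹ • X.halfspace a b = x⁻¹ • X.halfspace a b) ⟨x, rfl⟩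
    refine ⟨x * (r (x⁻¹ • X.halfspace a b))⁻¹, (hH _).2 ?_, _,
      Set.mem_image_of_mem r (x := x⁻¹ • X.halfspace a b) ?_, inv_mul_cancel_right _ _⟩
    · rw [mul_smul, hr, smul_inv_smul]
    · have h1 : ∃ c d, X.graph.Adj c d ∧ x⁻¹ • X.halfspace a b = X.halfspace c d :=
        ⟨_, _, (hinv.adj_smul x⁻¹).2 hab, hinv.smul_halfspace hX x⁻¹ hav hbv⟩
      have h2 : x ∈ (fun y => y * g) '' {y : G | y • v ∈ X.halfspace a b} ↔
          x • g⁻¹ • v ∈ X.halfspace a b := by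
        rw [← mul_smul]
        constructor
        · rintro ⟨y, hy, rfl⟩
          simpa using hy
        · exact fun h => ⟨x * g⁻¹, h, inv_mul_cancel_right _ _⟩
      rw [Set.mem_symmDiff, h2] at hx
      simp only [Set.mem_union, Set.mem_ofPred_eq, h1, true_and,
        Set.mem_smul_set_iff_inv_smul_mem, inv_inv] at hx ⊢
      tauto
  · have : {g : G | g • v ∈ X.halfspace a b}ᶜ = {g | g • v ∈ X.halfspace b a} := by
      ext g
      exact (mem_halfspace_symm hX hab (hvg g)).symm
    rw [this]
    exact hY.not_isHFinite hX hinv hnoinv hb ha hab.symm hv hH'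

end Stabilizer

end CubeComplex

/-! ### Codimension-1 subgroups of virtually abelian groups -/

theorem Group.fg_of_finiteIndex {G : Type*} [Group G] (N : Subgroup G) [N.FiniteIndex]
    [hN : Group.FG N] : Group.FG G := by
  obtain ⟨S, hS, hSf⟩ := Group.fg_iff.1 hN
  have hfin : Finite (G ⧸ N) := inferInstance
  refine Group.fg_iff.2 ⟨(N.subtype '' S) ∪ Set.range (fun q : G ⧸ N => q.out), ?_,
    (hSf.image _).union (Set.finite_range _)⟩
  have hNle : N ≤ Subgroup.closure ((N.subtype '' S) ∪ Set.range (fun q : G ⧸ N => q.out)) := by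
    refine le_trans ?_ (Subgroup.closure_mono Set.subset_union_left)
    rw [← MonoidHom.map_closure, hS, ← MonoidHom.range_eq_map, N.range_subtype]
  refine (Subgroup.eq_top_iff' _).2 fun g => ?_
  have h1 : (g : G ⧸ N).out⁻¹ * g ∈ N :=
    QuotientGroup.eq.1 (QuotientGroup.out_eq' (g : G ⧸ N))
  have := Subgroup.mul_mem _ (Subgroup.subset_closure (Set.mem_union_right (N.subtype '' S)
    (Set.mem_range_self (f := fun q : G ⧸ N => q.out) (g : G ⧸ N)))) (hNle h1)
  rwa [mul_inv_cancel_left] at this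

/-! ### Almost invariant subsets of abelian groups -/

section Ends

variable {Q : Type*} [AddCommGroup Q] {B : Set Q}

/-- If the complement were infinite, infinitely many of its elements would lie in one coset of `E`.
Translating that coset to one outside `E` moves all of them into `B`, against almost invariance. -/
theorem finite_compl_of_almost_invariant (hB : ∀ q : Q, {x | ¬ (x ∈ B ↔ x + q ∈ B)}.Finite)
    (S : AddSubgroup Q) [Infinite (Q ⧸ S)] {E : Set (Q ⧸ S)} (hE : E.Finite)
    (hEB : ∀ x : Q, (x : Q ⧸ S) ∉ E → x ∈ B) : Bᶜ.Finite := by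
  by_contra hinf
  obtain ⟨c, hc, hcinf⟩ : ∃ c ∈ E, {x : Q | x ∉ B ∧ (x : Q ⧸ S) = c}.Infinite := by
    by_contra! hcon
    refine hinf ((hE.biUnion hcon).subset fun x hx => ?_)
    exact Set.mem_biUnion (x := (x : Q ⧸ S)) (not_not.1 fun h => hx (hEB x h)) ⟨hx, rfl⟩
  obtain ⟨d, hd⟩ := hE.exists_notMem
  obtain ⟨t, ht⟩ := QuotientAddGroup.mk_surjective (d - c)
  refine hcinf ((hB t).subset ?_)
  rintro x ⟨hx, rfl⟩
  have : x + t ∈ B := hEB _ (by rw [QuotientAddGroup.mk_add, ht]; simpa using hd)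
  exact fun h => hx (h.2 this)

/-- An abelian group with at least two ends is virtually infinite cyclic. -/
theorem finite_quotient_zmultiples (hB : ∀ q : Q, {x | ¬ (x ∈ B ↔ x + q ∈ B)}.Finite)
    (h₁ : B.Infinite) (h₂ : Bᶜ.Infinite) {a : Q} (ha : ∀ n : ℤ, n • a = 0 → n = 0) :
    Finite (Q ⧸ AddSubgroup.zmultiples a) := by
  by_contra hfin
  rw [not_finite_iff_infinite] at hfin
  let mk : Q → Q ⧸ AddSubgroup.zmultiples a := fun x => x
  -- Outside these finitely many cosets of `⟨a⟩`, each coset lies wholly in `B` or wholly in its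
  -- complement. Two such cosets of different type would differ by a translation changing membership
  -- at infinitely many points.
  set E := mk '' {x | ¬ (x ∈ B ↔ x + a ∈ B)} with hEdef
  have hE : E.Finite := (hB a).image _
  have hmk : ∀ (x : Q) (n : ℤ), mk (x + n • a) = mk x := fun x n => by
    refine QuotientAddGroup.eq.2 ?_
    simp
  have hstep : ∀ x, mk x ∉ E → (x ∈ B ↔ x + a ∈ B) := fun x hx =>
    not_not.1 fun h => hx ⟨x, h, rfl⟩
  have hnat : ∀ n : ℕ, ∀ x, mk x ∉ E → (x ∈ B ↔ x + (n : ℤ) • a ∈ B) := by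
    intro n
    induction n with
    | zero => simp
    | succ n ih =>
      intro x hx
      rw [ih x hx, hstep _ (by rwa [hmk])]
      push_cast
      rw [add_smul, one_smul, add_assoc]
  have hconst : ∀ n : ℤ, ∀ x, mk x ∉ E → (x ∈ B ↔ x + n • a ∈ B) := by
    intro n x hx
    obtain ⟨m, rfl | rfl⟩ := n.eq_nat_or_neg
    · exact hnat m x hx
    · rw [hnat m (x + (-(m : ℤ)) • a) (by rwa [hmk])]
      simp
  have hsame : ∀ x y, mk x ∉ E → mk y ∉ E → x ∈ B → y ∈ B := by
    intro x y hx hy hxB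
    by_contra hyB
    have hinj : Function.Injective fun n : ℤ => x + n • a := by
      intro m n h
      have := ha (m - n) (by rw [sub_smul, sub_eq_zero]; exact add_left_cancel h)
      omega
    refine Set.infinite_range_of_injective hinj ((hB (y - x)).subset ?_)
    rintro _ ⟨n, rfl⟩ h
    rw [← hconst n x hx, show x + n • a + (y - x) = y + n • a by abel, ← hconst n y hy] at h
    exact hyB (h.1 hxB)
  by_cases hall : ∀ x, mk x ∉ E → x ∈ B
  · exact h₂ (finite_compl_of_almost_invariant hB _ hE hall)
  · push Not at hall
    obtain ⟨y, hy, hyB⟩ := hall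
    refine h₁ ?_
    rw [← compl_compl B]
    refine finite_compl_of_almost_invariant (B := Bᶜ) (fun q => ?_) _ hE
      fun x hx hxB => hyB (hsame x y hx hy hxB)
    simpa only [Set.mem_compl_iff, not_iff_not] using hB q

theorem finrank_eq_one_of_almost_invariant [Module.Finite ℤ Q]
    (hB : ∀ q : Q, {x | ¬ (x ∈ B ↔ x + q ∈ B)}.Finite) (h₁ : B.Infinite) (h₂ : Bᶜ.Infinite) :
    Module.finrank ℤ Q = 1 := by
  have hinf : Infinite Q := Set.infinite_univ_iff.1 (h₁.mono (Set.subset_univ _))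
  have hnt : ¬ Module.IsTorsion ℤ Q := fun ht =>
    have := Module.finite_of_fg_torsion Q ht
    not_finite Q
  obtain ⟨a, ha⟩ : ∃ a : Q, ∀ n : ℤ, n • a = 0 → n = 0 := by
    by_contra! hcon
    refine hnt fun x => ?_
    obtain ⟨n, hn, hn0⟩ := hcon x
    exact ⟨⟨n, mem_nonZeroDivisors_of_ne_zero hn0⟩, hn⟩
  have hfin := finite_quotient_zmultiples hB h₁ h₂ ha
  let S : Submodule ℤ Q := AddSubgroup.toIntSubmodule (AddSubgroup.zmultiples a)
  have hS : S = Submodule.span ℤ {a} := by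
    ext x
    rw [Submodule.mem_span_singleton]
    exact AddSubgroup.mem_zmultiples_iff
  have hQS : Finite (Q ⧸ S) := hfin
  have h0 : Module.finrank ℤ (Q ⧸ S) = 0 := by
    refine Module.finrank_eq_zero_iff_isTorsion.2 fun x => ?_
    refine ⟨⟨(Nat.card (Q ⧸ S) : ℤ), mem_nonZeroDivisors_of_ne_zero
      (Nat.cast_ne_zero.2 Nat.card_pos.ne')⟩, ?_⟩
    show ((Nat.card (Q ⧸ S) : ℤ)) • x = 0
    rw [natCast_zsmul, card_nsmul_eq_zero']
  have h1 : Module.finrank ℤ S ≤ 1 := by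
    rw [hS]
    simpa using finrank_span_le_card (R := ℤ) ({a} : Set Q)
  have h2 := S.finrank_quotient_add_finrank
  have h3 := mt Module.finrank_eq_zero_iff_isTorsion.1 hnt
  omega

end Ends

/-! ### Passing to a finite-index subgroup -/

section Virtual

variable {G : Type*} [Group G]

theorem IsHFinite.union {H : Subgroup G} {A B : Set G} (hA : IsHFinite H A)
    (hB : IsHFinite H B) : IsHFinite H (A ∪ B) := by
  obtain ⟨E, hE, hAE⟩ := hA
  obtain ⟨F, hF, hBF⟩ := hB
  refine ⟨E ∪ F, hE.union hF, ?_⟩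
  rw [Set.mul_union]
  exact Set.union_subset_union hAE hBF

theorem IsHFinite.mono {H : Subgroup G} {A B : Set G} (hA : IsHFinite H A) (h : B ⊆ A) :
    IsHFinite H B := by
  obtain ⟨F, hF, hAF⟩ := hA
  exact ⟨F, hF, h.trans hAF⟩

theorem IsHFinite.image_mul_right {H : Subgroup G} {A : Set G} (hA : IsHFinite H A) (t : G) :
    IsHFinite H ((fun a => a * t) '' A) := by
  obtain ⟨F, hF, hAF⟩ := hA
  refine ⟨_, hF.image fun a => a * t, ?_⟩
  rintro _ ⟨a, ha, rfl⟩
  obtain ⟨h, hh, f, hf, rfl⟩ := hAF ha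
  exact ⟨h, hh, _, ⟨f, hf, rfl⟩, (mul_assoc h f t).symm⟩

theorem IsHFinite.biUnion {ι : Type*} {H : Subgroup G} {T : Set ι} (hT : T.Finite)
    {A : ι → Set G} (hA : ∀ t ∈ T, IsHFinite H (A t)) : IsHFinite H (⋃ t ∈ T, A t) := by
  choose! F hF hAF using hA
  refine ⟨⋃ t ∈ T, F t, hT.biUnion hF, Set.iUnion₂_subset fun t ht => (hAF t ht).trans ?_⟩
  exact Set.mul_subset_mul_left (Set.subset_biUnion_of_mem ht)

/-- An `H`-almost invariant set whose intersection with some finite-index subgroup is `H`-finite is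
itself `H`-finite. -/
theorem isHFinite_of_inter {H N : Subgroup G} [N.FiniteIndex] {A : Set G}
    (hA : ∀ g : G, IsHFinite H (symmDiff A ((fun a => a * g) '' A)))
    (hAN : IsHFinite H (A ∩ N)) : IsHFinite H A := by
  have hfin : Finite (G ⧸ N) := inferInstance
  refine IsHFinite.mono (IsHFinite.biUnion (Set.finite_range fun q : G ⧸ N => q.out)
    fun t _ => (hAN.union (hA t)).image_mul_right t⁻¹) fun g hg => ?_
  have h1 : ((g⁻¹ : G) : G ⧸ N).out⁻¹ * g⁻¹ ∈ N :=
    QuotientGroup.eq.1 (QuotientGroup.out_eq' ((g⁻¹ : G) : G ⧸ N))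
  refine Set.mem_biUnion (Set.mem_range_self ((g⁻¹ : G) : G ⧸ N)) ?_
  set t := ((g⁻¹ : G) : G ⧸ N).out
  have h2 : g * t ∈ N := by simpa using N.inv_mem h1
  -- The element `g * t` lies in `N`; it is either in `A` or in the difference between `A` and its
  -- right translate by `t`.
  refine ⟨g * t, ?_, by simp⟩
  by_cases h3 : g * t ∈ A
  · exact .inl ⟨h3, h2⟩
  · exact .inr (.inr ⟨⟨g, hg, rfl⟩, h3⟩)

theorem IsVirtuallyAbelianOfRank.fg {n : ℕ} (h : IsVirtuallyAbelianOfRank G n) : Group.FG G := by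
  obtain ⟨N, hN, ⟨e⟩⟩ := h
  have h1 : Group.FG (Multiplicative (Fin n → ℤ)) := by
    rw [Group.fg_iff_monoid_fg, Monoid.fg_iff_add_fg, ← AddGroup.fg_iff_addMonoid_fg]
    exact Module.Finite.iff_addGroup_fg.1 (inferInstance : Module.Finite ℤ (Fin n → ℤ))
  have : Group.FG N := Group.fg_of_surjective (f := e.symm.toMonoidHom) e.symm.surjective
  exact Group.fg_of_finiteIndex N

/-- Since `A` is a union of right cosets of `H`, it induces a subset `B` of `ℤⁿ / P` with `P` the
preimage of `H`, and `H`-finite sets induce finite ones. Thus `B` is almost invariant, and `B` and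
its complement are infinite, so the quotient has rank 1. The form `m + 1 = n` includes that `n` is
positive. -/
theorem IsCodimensionOne.isVirtuallyAbelianOfRank {H : Subgroup G} (hH : IsCodimensionOne H)
    {n : ℕ} (h : IsVirtuallyAbelianOfRank G n) :
    ∃ m : ℕ, m + 1 = n ∧ IsVirtuallyAbelianOfRank H m := by
  obtain ⟨N, hN, ⟨e⟩⟩ := h
  obtain ⟨A, hHA, hA, h₁, h₂⟩ := hH
  let j : (Fin n → ℤ) → G := fun m => (e.symm (Multiplicative.ofAdd m) : G)
  have hj_add : ∀ x y, j (x + y) = j x * j y := fun x y => by simp [j]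
  have hj_neg : ∀ x, j (-x) = (j x)⁻¹ := fun x => by simp [j]
  have hj_zero : j 0 = 1 := by simp [j]
  have hj_mem : ∀ g ∈ N, ∃ m, j m = g := fun g hg =>
    ⟨(e ⟨g, hg⟩).toAdd, by simp [j]⟩
  let P : Submodule ℤ (Fin n → ℤ) := AddSubgroup.toIntSubmodule
    { carrier := {m | j m ∈ H}
      add_mem' := fun hx hy => by
        rw [Set.mem_ofPred_eq, hj_add]; exact H.mul_mem hx hy
      zero_mem' := by rw [Set.mem_ofPred_eq, hj_zero]; exact H.one_mem
      neg_mem' := fun hx => by rw [Set.mem_ofPred_eq, hj_neg]; exact H.inv_mem hx }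
  have hP : ∀ m, m ∈ P ↔ j m ∈ H := fun m => Iff.rfl
  let B : Set ((Fin n → ℤ) ⧸ P) := P.mkQ '' (j ⁻¹' A)
  have hB : ∀ m, P.mkQ m ∈ B ↔ j m ∈ A := by
    intro m
    constructor
    · rintro ⟨x, hx, he⟩
      have h3 : m - x ∈ P := (Submodule.Quotient.eq P).1 he.symm
      have h4 : j m = j (m - x) * j x := by rw [← hj_add, sub_add_cancel]
      rw [← hHA, h4]
      exact Set.mul_mem_mul h3 hx
    · exact fun hm => ⟨m, hm, rfl⟩
  have hfin : ∀ S : Set G, IsHFinite H S → (P.mkQ '' (j ⁻¹' S)).Finite := by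
    rintro S ⟨F, hF, hSF⟩
    refine (hF.biUnion (t := fun f => P.mkQ '' {m | j m * f⁻¹ ∈ H}) fun f _ =>
      Set.Subsingleton.finite ?_).subset ?_
    · rintro _ ⟨x, hx, rfl⟩ _ ⟨y, hy, rfl⟩
      refine (Submodule.Quotient.eq P).2 ((hP _).2 ?_)
      have h3 := H.mul_mem hx (H.inv_mem hy)
      rw [sub_eq_add_neg, hj_add, hj_neg]
      simpa using h3
    · rintro _ ⟨x, hx, rfl⟩
      obtain ⟨h, hh, f, hf, he⟩ := hSF hx
      refine Set.mem_biUnion hf ⟨x, ?_, rfl⟩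
      show j x * f⁻¹ ∈ H
      rw [← show h * f = j x from he, mul_inv_cancel_right]
      exact hh
  have hfin' : ∀ S : Set G, (P.mkQ '' (j ⁻¹' S)).Finite → IsHFinite H (S ∩ N) := by
    intro S hS
    refine ⟨_, hS.image fun q => j (Quotient.out q), ?_⟩
    rintro g ⟨hg, hgN⟩
    obtain ⟨m, rfl⟩ := hj_mem g hgN
    have h3 : m - Quotient.out (P.mkQ m) ∈ P :=
      (Submodule.Quotient.eq P).1 (Quotient.out_eq (P.mkQ m)).symm
    refine ⟨_, h3, _, ⟨P.mkQ m, ⟨m, hg, rfl⟩, rfl⟩, ?_⟩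
    show j _ * j _ = j m
    rw [← hj_add, sub_add_cancel]
  have hcompl : ∀ g : G, symmDiff Aᶜ ((fun a => a * g) '' Aᶜ) =
      symmDiff A ((fun a => a * g) '' A) := by
    intro g
    rw [Set.image_compl_eq (Group.mulRight_bijective g)]
    ext x
    simp only [Set.mem_symmDiff, Set.mem_compl_iff]
    tauto
  have hBc : Bᶜ = P.mkQ '' (j ⁻¹' Aᶜ) := by
    ext q
    obtain ⟨m, rfl⟩ := P.mkQ_surjective q
    rw [Set.mem_compl_iff, hB]
    constructor
    · exact fun hm => ⟨m, hm, rfl⟩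
    · rintro ⟨x, hx, he⟩
      rw [← hB, ← he, hB]
      exact hx
  have hrank : Module.finrank ℤ ((Fin n → ℤ) ⧸ P) = 1 := by
    refine finrank_eq_one_of_almost_invariant (B := B) (fun q => ?_) (fun hf => ?_) (fun hf => ?_)
    · obtain ⟨t, rfl⟩ := P.mkQ_surjective q
      refine (hfin _ (hA (j t)⁻¹)).subset ?_
      intro x hx
      obtain ⟨x, rfl⟩ := P.mkQ_surjective x
      refine ⟨x, ?_, rfl⟩
      rw [Set.mem_ofPred_eq, ← map_add, hB, hB, hj_add] at hx
      rw [Set.mem_preimage, Set.mem_symmDiff]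
      have h3 : j x ∈ (fun a => a * (j t)⁻¹) '' A ↔ j x * j t ∈ A := by
        constructor
        · rintro ⟨y, hy, he⟩
          rw [← he]
          simpa using hy
        · exact fun h => ⟨_, h, by simp⟩
      rw [h3]
      tauto
    · exact h₁ (isHFinite_of_inter hA (hfin' A hf))
    · rw [hBc] at hf
      exact h₂ (isHFinite_of_inter (fun g => by rw [hcompl]; exact hA g) (hfin' Aᶜ hf))
  have hsum := P.finrank_quotient_add_finrank
  rw [hrank, Module.finrank_fin_fun] at hsum
  refine ⟨Module.finrank ℤ P, by omega, N.subgroupOf H, inferInstance, ⟨?_⟩⟩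
  let f : N.subgroupOf H ≃* Multiplicative P :=
    { toFun := fun x => Multiplicative.ofAdd ⟨(e ⟨x.1.1, x.2⟩).toAdd, (hP _).2 (by simp [j])⟩
      invFun := fun m => ⟨⟨j m.toAdd.1, m.toAdd.2⟩, (e.symm _).2⟩
      left_inv := fun x => by simp [j]
      right_inv := fun m => by
        refine Multiplicative.toAdd.injective (Subtype.ext ?_)
        show (e (e.symm (Multiplicative.ofAdd m.toAdd.1))).toAdd = m.toAdd.1
        rw [e.apply_symm_apply]
        rfl
      map_mul' := fun x y => by
        rw [← ofAdd_add]
        congr 1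
        ext1
        show (e ⟨x.1.1 * y.1.1, _⟩).toAdd = (e ⟨x.1.1, x.2⟩).toAdd + (e ⟨y.1.1, y.2⟩).toAdd
        rw [← toAdd_mul, ← map_mul]
        rfl }
  exact f.trans (AddEquiv.toMultiplicative (Module.finBasis ℤ P).equivFun.toAddEquiv)

end Virtual

theorem mainTheorem8 {G V : Type*} [Group G] [MulAction G V] (X : CubeComplex V)
    (hX : X.IsCAT0) (hinv : X.IsInvariant G)
    (hfix : X.NoFixedPoint G) (hnoinv : X.NoInversions G) :
    (Group.FG G → ∃ X₀ : CubeComplex V, X.IsMinimalInvariantConvex G X₀ ∧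
      (X₀.hyperplaneOrbits G).Finite ∧
      ∀ L ∈ X₀.hyperplanes, IsCodimensionOne (CubeComplex.hyperplaneStabilizer G L)) ∧
    (∀ n : ℕ, IsVirtuallyAbelianOfRank G n →
      ∃ X₀ : CubeComplex V, X.IsMinimalInvariantConvex G X₀ ∧
      (X₀.hyperplaneOrbits G).Finite ∧
      ∀ L ∈ X₀.hyperplanes, ∃ m : ℕ, m + 1 = n ∧
        IsVirtuallyAbelianOfRank (CubeComplex.hyperplaneStabilizer G L) m) := by
  constructor
  · intro hG
    obtain ⟨Y, hY, hmin, hfin⟩ := CubeComplex.exists_isMinimalInvariantConvex hG hX hinv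
    exact ⟨_, hmin, hfin, fun L hL => hY.isCodimensionOne hX hinv hnoinv hL⟩
  · intro n hn
    obtain ⟨Y, hY, hmin, hfin⟩ := CubeComplex.exists_isMinimalInvariantConvex hn.fg hX hinv
    exact ⟨_, hmin, hfin, fun L hL =>
      (hY.isCodimensionOne hX hinv hnoinv hL).isVirtuallyAbelianOfRank hn⟩
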